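/- Let $I\subset\mathbb{R}$ be a nondegenerate interval, let $f:I\to\mathbb{R}$ be continuous and strictly increasing, and let $p:I\to(0,\infty)$ be Borel measurable. For $n\in\mathbb{N}$ and $x_1,\dots,x_n\in I$ let $$\mathscr{B}^{f,p}_n(x_1,\dots,x_n):=f^{-1}\left(\frac{\sum_{i=1}^n p(x_i)f(x_i)}{\sum_{i=1}^n p(x_i)}\right),\qquad \mathscr{A}^{f}_n(x_1,\dots,x_n):=f^{-1}\left(\frac1n\sum_{i=1}^n f(x_i)\right)$$ be the Bajraktarević mean with generator $(f,p)$ and the quasi-arithmetic mean with generator $f$. Let $(\xi_n)_{n\ge1}$ be i.i.d. real random variables with $\mathbb{P}(\xi_1\in I)=1$ such that $\xi_1$ is not almost surely constant. (a) Suppose that $\mathbb{E}(p(\xi_1)^2)<\infty$ and $\mathbb{E}(p(\xi_1)^2f(\xi_1)^2)<\infty$. Suppose that $$t_0:=f^{-1}\left(\frac{\mathbb{E}(p(\xi_1)f(\xi_1))}{\mathbb{E}(p(\xi_1))}\right)$$ belongs to the interior of $I$ and that $f$ is differentiable at $t_0$ with $f'(t_0)\neq0$. Then $t_0$ is well defined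 (that is, $f(t_0)=\mathbb{E}(p(\xi_1)f(\xi_1))/\mathbb{E}(p(\xi_1))$), the number $$\sigma_{f,p}^2:=\frac{(\mathbb{E}(p(\xi_1)))^{-4}}{(f'(t_0))^2}\Big((\mathbb{E}(p(\xi_1)))^2\operatorname{Var}(p(\xi_1)f(\xi_1))+(\mathbb{E}(p(\xi_1)f(\xi_1)))^2\operatorname{Var}(p(\xi_1))-2\,\mathbb{E}(p(\xi_1))\,\mathbb{E}(p(\xi_1)f(\xi_1))\operatorname{Cov}(p(\xi_1),p(\xi_1)f(\xi_1))\Big)$$ is positive, and almost surely $$\limsup_{n\to\infty}\frac{\mathscr{B}^{f,p}_n(\xi_1,\dots,\xi_n)-t_0}{\sqrt{2n^{-1}\ln\ln n}}=\sqrt{\sigma_{f,p}^2},\qquad \liminf_{n\to\infty}\frac{\mathscr{B}^{f,p}_n(\xi_1,\dots,\xi_n)-t_0}{\sqrt{2n^{-1}\ln\ln n}}=-\sqrt{\sigma_{f,p}^2}.$$ (b) In particular (the case $p\equiv1$), suppose that $\mathbb{E}(f(\xi_1)^2)<\infty$, that $\mathbb{A}^f(\xi_1):=f^{-1}(\mathbb{E}(f(\xi_1)))$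 belongs to the interior of $I$, and that $f$ is differentiable at $\mathbb{A}^f(\xi_1)$ with a nonzero derivative. Then $\mathbb{A}^f(\xi_1)$ is well defined (that is, $f(\mathbb{A}^f(\xi_1))=\mathbb{E}(f(\xi_1))$), and almost surely $$\limsup_{n\to\infty}\frac{\mathscr{A}^{f}_n(\xi_1,\dots,\xi_n)-\mathbb{A}^f(\xi_1)}{\sqrt{2n^{-1}\ln\ln n}}=\frac{\sqrt{\operatorname{Var}(f(\xi_1))}}{f'(\mathbb{A}^f(\xi_1))},\qquad \liminf_{n\to\infty}\frac{\mathscr{A}^{f}_n(\xi_1,\dots,\xi_n)-\mathbb{A}^f(\xi_1)}{\sqrt{2n^{-1}\ln\ln n}}=-\frac{\sqrt{\operatorname{Var}(f(\xi_1))}}{f'(\mathbb{A}^f(\xi_1))}.$$ -/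

import Mathlib

open MeasureTheory ProbabilityTheory Filter

noncomputable section

/-- The inverse `f⁻¹ : f(I) → I` of a function `f` that is injective on `I`
(only its values on `f '' I` are meaningful). -/
def genInv (I : Set ℝ) (f : ℝ → ℝ) (y : ℝ) : ℝ :=
  Function.invFunOn f I y

/-- The `n`-variable Bajraktarević mean with generator `(f, p)` on the interval `I`. -/
def bajMean (I : Set ℝ) (f p : ℝ → ℝ) {n : ℕ} (x : Fin n → ℝ) : ℝ :=
  genInv I f ((∑ i, p (x i) * f (x i)) / ∑ i, p (x i))

/-- The `n`-variable quasi-arithmetic mean with generator `f` on the interval `I`. -/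
def quasiMean (I : Set ℝ) (f : ℝ → ℝ) {n : ℕ} (x : Fin n → ℝ) : ℝ :=
  genInv I f ((1 / (n : ℝ)) * ∑ i, f (x i))

/-- The Bajraktarević expected value `f⁻¹ (E[p(ξ) f(ξ)] / E[p(ξ)])` of `ξ`. -/
def bajExpectation {Ω : Type*} [MeasurableSpace Ω] (P : Measure Ω) (I : Set ℝ)
    (f p : ℝ → ℝ) (ξ : Ω → ℝ) : ℝ :=
  genInv I f ((∫ ω, p (ξ ω) * f (ξ ω) ∂P) / ∫ ω, p (ξ ω) ∂P)

/-- Kolmogorov's quasi-arithmetic expected value `f⁻¹ (E[f(ξ)])` of `ξ`. -/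
def quasiExpectation {Ω : Type*} [MeasurableSpace Ω] (P : Measure Ω) (I : Set ℝ)
    (f : ℝ → ℝ) (ξ : Ω → ℝ) : ℝ :=
  genInv I f (∫ ω, f (ξ ω) ∂P)

/-- The asymptotic variance `σ²_{f,p}`. -/
def bajSigmaSq {Ω : Type*} [MeasurableSpace Ω] (P : Measure Ω) (I : Set ℝ)
    (f p : ℝ → ℝ) (ξ : Ω → ℝ) : ℝ :=
  ((∫ ω, p (ξ ω) ∂P) ^ 4)⁻¹ / (deriv f (bajExpectation P I f p ξ)) ^ 2 *
    ((∫ ω, p (ξ ω) ∂P) ^ 2 * variance (fun ω => p (ξ ω) * f (ξ ω)) P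
      + (∫ ω, p (ξ ω) * f (ξ ω) ∂P) ^ 2 * variance (fun ω => p (ξ ω)) P
      - 2 * (∫ ω, p (ξ ω) ∂P) * (∫ ω, p (ξ ω) * f (ξ ω) ∂P) *
          covariance (fun ω => p (ξ ω)) (fun ω => p (ξ ω) * f (ξ ω)) P)

/-- The normalizing factor `√(2 n⁻¹ ln ln n)` (meaningful for `n ≥ 3`). -/
def lilScale (n : ℕ) : ℝ :=
  √(2 * (n : ℝ)⁻¹ * Real.log (Real.log n))

/-- The Bajraktarević mean of points of `I` is well defined: it lies in `I`, and it solves the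
equation that defines it. -/
theorem bajMean_spec {I : Set ℝ} (hI : I.OrdConnected) {f p : ℝ → ℝ}
    (hf : ContinuousOn f I) (hp : ∀ x ∈ I, 0 < p x) {n : ℕ} (hn : 0 < n)
    (x : Fin n → ℝ) (hx : ∀ i, x i ∈ I) :
    bajMean I f p x ∈ I ∧
      f (bajMean I f p x) = (∑ i, p (x i) * f (x i)) / ∑ i, p (x i) := by
  have hconv : Convex ℝ (f '' I) :=
    ((hI.isPreconnected.image f hf).ordConnected).convex
  have : Nonempty (Fin n) := ⟨⟨0, hn⟩⟩
  have hmem : (∑ i, p (x i) * f (x i)) / ∑ i, p (x i) ∈ f '' I := by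
    have h := hconv.centerMass_mem (t := Finset.univ) (w := fun i => p (x i))
      (z := fun i => f (x i)) (fun i _ => (hp _ (hx i)).le)
      (Finset.sum_pos (fun i _ => hp _ (hx i)) Finset.univ_nonempty)
      (fun i _ => ⟨x i, hx i, rfl⟩)
    simpa [Finset.centerMass, div_eq_inv_mul] using h
  exact ⟨Function.invFunOn_mem hmem, Function.invFunOn_eq hmem⟩

/-- The quasi-arithmetic mean is the Bajraktarević mean with constant weight `1`. -/
theorem bajMean_one (I : Set ℝ) (f : ℝ → ℝ) {n : ℕ} (x : Fin n → ℝ) :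
    bajMean I f (fun _ => 1) x = quasiMean I f x := by
  simp [bajMean, quasiMean, div_eq_inv_mul]

end

open scoped Topology

/-! Put X_i = p(ξ_i)(f(ξ_i) - f(t₀)). These variables are i.i.d., centred by the choice of t₀,
square integrable, and not a.s. zero because f is injective and p > 0. The means B_n satisfy the
exact identity f(B_n) - f(t₀) = (ΣX_i/n) / (Σp(ξ_i)/n). The denominator tends to E p(ξ) by the
strong law, B_n → t₀ by monotonicity, and differentiability turns f(B_n) - f(t₀) into (B_n - t₀)
times a factor tending to f'(t₀) (`IsRealLimsup.of_eq_mul`). The claim thus reduces to the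
Hartman-Wintner law for X_i and for -X_i (`ae_isRealLimsup_sum_div_lilScale`), which is proved here
from second moments alone.

Upper half (`ae_eventually_sum_le`): along ρ^k, truncate at a small multiple of d_k = √(ρ^k / log
k). Doob's maximal inequality for the exponential submartingale bounds the truncated part by
k^(-(1+ε)). The discarded part is handled by Markov's inequality and is summable because d_k grows
geometrically. Borel-Cantelli and interpolation between consecutive powers finish.

Lower half (`ae_frequently_le_sum`): the central limit theorem gives P(S_p ≥ u√p) ≥ exp(-(1+η)u²/2)
for one large fixed u and all large p. Concatenating about 2 log k / ((1+η)u²) independent blocks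
inside [ρ^k, ρ^(k+1)) yields a large increment with probability at least 1/k. The second
Borel-Cantelli lemma applies, and for large ρ the sum before ρ^k is negligible by the upper half for
-X. -/

/-! ### Exponential maximal inequality for bounded summands -/

theorem exp_le_one_add_add_mul_sq {y δ : ℝ} (hy : |y| ≤ δ) (hδ : δ ≤ 1) :
    Real.exp y ≤ 1 + y + (1 + δ) / 2 * y ^ 2 := by
  have h := (abs_le.1 (Real.exp_bound (hy.trans hδ) (n := 3) (by norm_num))).2
  simp only [Finset.sum_range_succ, Finset.sum_range_zero, Nat.factorial] at h
  have h2 : |y| ^ 3 = |y| * y ^ 2 := by rw [pow_succ, sq_abs]; ring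
  rw [h2] at h
  norm_num at h
  nlinarith [mul_le_mul_of_nonneg_right hy (sq_nonneg y), abs_nonneg y, sq_nonneg y,
    mul_nonneg (abs_nonneg y) (sq_nonneg y)]

section

variable {Ω : Type*} [MeasurableSpace Ω] {P : Measure Ω} [IsProbabilityMeasure P]

theorem integrable_of_forall_abs_le {Y : Ω → ℝ} (hY : Measurable Y) {c : ℝ}
    (hc : ∀ ω, |Y ω| ≤ c) : Integrable Y P :=
  .of_bound hY.aestronglyMeasurable c (ae_of_all _ hc)

theorem integrable_exp_mul_of_forall_abs_le {Y : Ω → ℝ} (hY : Measurable Y) {c : ℝ}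
    (hc : ∀ ω, |Y ω| ≤ c) (l : ℝ) : Integrable (fun ω => Real.exp (l * Y ω)) P := by
  refine integrable_of_forall_abs_le (by fun_prop) (c := Real.exp (|l| * c)) fun ω => ?_
  rw [Real.abs_exp, Real.exp_le_exp]
  calc l * Y ω ≤ |l * Y ω| := le_abs_self _
    _ = |l| * |Y ω| := abs_mul _ _
    _ ≤ |l| * c := by gcongr; exact hc ω

/-- Integrating the quadratic bound for exp, centring removes the linear term. The factor (1 + δ) /
2, close to the Gaussian 1/2, is what makes the final constant sharp. -/
theorem mgf_le_exp_of_forall_abs_le {Y : Ω → ℝ} (hY : Measurable Y) {c l δ : ℝ}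
    (hc : ∀ ω, |Y ω| ≤ c) (h0 : ∫ ω, Y ω ∂P = 0) (h1 : ∫ ω, Y ω ^ 2 ∂P ≤ 1)
    (hl : 0 ≤ l) (hlc : l * c ≤ δ) (hδ : δ ≤ 1) :
    mgf Y P l ≤ Real.exp (l ^ 2 * (1 + δ) / 2) := by
  have hδ0 : 0 ≤ δ := by
    obtain ⟨ω⟩ := nonempty_of_isProbabilityMeasure P
    exact (mul_nonneg hl ((abs_nonneg _).trans (hc ω))).trans hlc
  have hint := integrable_of_forall_abs_le (P := P) hY hc
  have hint2 : Integrable (fun ω => Y ω ^ 2) P :=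
    integrable_of_forall_abs_le (by fun_prop) (c := c ^ 2) fun ω => by
      rw [abs_pow]; gcongr; exact hc ω
  calc mgf Y P l ≤ ∫ ω, (1 + l * Y ω + (1 + δ) / 2 * l ^ 2 * Y ω ^ 2) ∂P := by
        refine integral_mono (integrable_exp_mul_of_forall_abs_le hY hc l)
          (((integrable_const _).add (hint.const_mul _)).add (hint2.const_mul _)) fun ω => ?_
        have := exp_le_one_add_add_mul_sq (y := l * Y ω) (δ := δ) (by
          rw [abs_mul, abs_of_nonneg hl]
          exact (mul_le_mul_of_nonneg_left (hc ω) hl).trans hlc) hδ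
        simp only
        linarith [mul_pow l (Y ω) 2, congrArg (fun z => (1 + δ) / 2 * z) (mul_pow l (Y ω) 2)]
    _ = 1 + (1 + δ) / 2 * l ^ 2 * ∫ ω, Y ω ^ 2 ∂P := by
        have hlin : Integrable (fun ω => 1 + l * Y ω) P :=
          (integrable_const _).add (hint.const_mul _)
        rw [integral_add hlin (hint2.const_mul _),
          integral_add (integrable_const _) (hint.const_mul _), integral_const_mul,
          integral_const_mul, h0]
        simp
    _ ≤ 1 + l ^ 2 * (1 + δ) / 2 := by
        have : 0 ≤ (1 + δ) / 2 * l ^ 2 := by positivity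
        nlinarith
    _ ≤ _ := by rw [add_comm]; exact Real.add_one_le_exp _

/-- Since e^x ≥ 1 + x and the summands are centred, each new factor has mean at least 1; being
independent of the past, it can only increase the integral over a past event. -/
theorem submartingale_exp_sum {Y : ℕ → Ω → ℝ} (hY : ∀ i, Measurable (Y i)) (hind : iIndepFun Y P)
    {c : ℝ} (hc : ∀ i ω, |Y i ω| ≤ c) (h0 : ∀ i, ∫ ω, Y i ω ∂P = 0) (l : ℝ) :
    Submartingale (fun n ω => Real.exp (l * ∑ i ∈ Finset.range (n + 1), Y i ω))
      (Filtration.natural Y fun i => (hY i).stronglyMeasurable) P := by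
  have hbd (n : ℕ) (ω : Ω) : |∑ i ∈ Finset.range n, Y i ω| ≤ n * c := by
    refine (Finset.abs_sum_le_sum_abs _ _).trans ((Finset.sum_le_sum fun i _ => hc i ω).trans ?_)
    simp
  have hint (n : ℕ) : Integrable (fun ω => Real.exp (l * ∑ i ∈ Finset.range n, Y i ω)) P :=
    integrable_exp_mul_of_forall_abs_le (by fun_prop) (hbd n) l
  set 𝓕 := Filtration.natural Y fun i => (hY i).stronglyMeasurable
  have hadp : StronglyAdapted 𝓕
      (fun n ω => Real.exp (l * ∑ i ∈ Finset.range (n + 1), Y i ω)) := by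
    intro n
    have : ∀ i ∈ Finset.range (n + 1), StronglyMeasurable[𝓕 n] (Y i) := fun i hi =>
      (Filtration.stronglyAdapted_natural (fun i => (hY i).stronglyMeasurable) i).mono
        (𝓕.mono (Nat.lt_succ_iff.1 (Finset.mem_range.1 hi)))
    exact Real.continuous_exp.comp_stronglyMeasurable
      ((Finset.stronglyMeasurable_fun_sum _ this).const_mul l)
  refine submartingale_of_setIntegral_le_succ hadp (fun n => hint _) fun n s hs => ?_
  have hs' : MeasurableSet s := 𝓕.le n s hs
  have hindep : IndepFun (s.indicator fun ω => Real.exp (l * ∑ i ∈ Finset.range (n + 1), Y i ω))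
      (fun ω => Real.exp (l * Y (n + 1) ω)) P := by
    have h1 := (hind.indep_comap_natural_of_lt (fun i => (hY i).stronglyMeasurable)
      (Nat.lt_succ_self n)).symm
    rw [IndepFun_iff_Indep]
    refine indep_of_indep_of_le_left (indep_of_indep_of_le_right h1 ?_) ?_
    · have : Measurable[MeasurableSpace.comap (Y (n + 1)) inferInstance]
          (fun ω => Real.exp (l * Y (n + 1) ω)) :=
        (show Measurable fun x : ℝ => Real.exp (l * x) by fun_prop).comp (comap_measurable _)
      exact this.comap_le
    · exact ((hadp n).indicator hs).measurable.comap_le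
  have hexp : 1 ≤ ∫ ω, Real.exp (l * Y (n + 1) ω) ∂P := by
    calc (1 : ℝ) = ∫ ω, (1 + l * Y (n + 1) ω) ∂P := by
          rw [integral_add (integrable_const _)
            ((integrable_of_forall_abs_le (hY _) (hc _)).const_mul _), integral_const_mul, h0]
          simp
      _ ≤ _ := by
          refine integral_mono ((integrable_const _).add
            ((integrable_of_forall_abs_le (hY _) (hc _)).const_mul _))
            (integrable_exp_mul_of_forall_abs_le (hY _) (hc _) l) fun ω => ?_
          have := Real.add_one_le_exp (l * Y (n + 1) ω)
          simp only
          linarith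
  have hprod : ∫ ω in s, Real.exp (l * ∑ i ∈ Finset.range (n + 1 + 1), Y i ω) ∂P =
      (∫ ω in s, Real.exp (l * ∑ i ∈ Finset.range (n + 1), Y i ω) ∂P) *
        ∫ ω, Real.exp (l * Y (n + 1) ω) ∂P := by
    rw [← integral_indicator hs', ← integral_indicator hs',
      ← hindep.integral_fun_mul_eq_mul_integral]
    · congr with ω
      by_cases hω : ω ∈ s <;> simp [hω, Finset.sum_range_succ _ (n + 1), mul_add, Real.exp_add]
    · exact ((hint _).indicator hs').aestronglyMeasurable
    · exact (integrable_exp_mul_of_forall_abs_le (hY _) (hc _) l).aestronglyMeasurable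
  rw [hprod]
  exact le_mul_of_one_le_right (setIntegral_nonneg hs' fun ω _ => (Real.exp_pos _).le) hexp

theorem measureReal_exists_le_sum_le {Y : ℕ → Ω → ℝ} (hY : ∀ i, Measurable (Y i))
    (hind : iIndepFun Y P) {c l δ x : ℝ} (hc : ∀ i ω, |Y i ω| ≤ c) (h0 : ∀ i, ∫ ω, Y i ω ∂P = 0)
    (h1 : ∀ i, ∫ ω, Y i ω ^ 2 ∂P ≤ 1) (hl : 0 ≤ l) (hlc : l * c ≤ δ) (hδ : δ ≤ 1)
    (hx : 0 < x) (N : ℕ) :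
    P.real {ω | ∃ n ≤ N, x ≤ ∑ i ∈ Finset.range n, Y i ω} ≤
      Real.exp (-(l * x) + N * (l ^ 2 * (1 + δ) / 2)) := by
  -- The submartingale at time n carries n + 1 summands, so the horizon N + 1 corresponds to time N.
  -- The empty sum never reaches the level since x > 0.
  rcases N with _ | N
  · have : {ω | ∃ n ≤ 0, x ≤ ∑ i ∈ Finset.range n, Y i ω} = ∅ := by
      ext ω; simp [hx]
    rw [this]
    simp only [measureReal_empty]
    positivity
  have hsub := submartingale_exp_sum hY hind hc h0 l
  have hmax := maximal_ineq hsub (fun n ω => (Real.exp_pos _).le)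
    (ε := ⟨Real.exp (l * x), (Real.exp_pos _).le⟩) N
  set A := {ω | ((⟨Real.exp (l * x), (Real.exp_pos _).le⟩ : NNReal) : ℝ) ≤
    (Finset.range (N + 1)).sup' Finset.nonempty_range_add_one fun k =>
      Real.exp (l * ∑ i ∈ Finset.range (k + 1), Y i ω)}
  have hAsub : {ω | ∃ n ≤ N + 1, x ≤ ∑ i ∈ Finset.range n, Y i ω} ⊆ A := by
    rintro ω ⟨n, hn, hxn⟩
    rcases n with _ | n
    · simp at hxn; linarith
    simp only [A, Set.mem_ofPred_eq, Finset.le_sup'_iff]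
    exact ⟨n, by simpa using hn, Real.exp_le_exp.2 (by gcongr)⟩
  have hmgf : ∫ ω, Real.exp (l * ∑ i ∈ Finset.range (N + 1), Y i ω) ∂P ≤
      Real.exp ((N + 1 : ℕ) * (l ^ 2 * (1 + δ) / 2)) := by
    have := hind.mgf_sum hY (Finset.range (N + 1)) (t := l)
    simp only [mgf, Finset.sum_apply] at this
    rw [this, Real.exp_nat_mul]
    calc _ ≤ ∏ i ∈ Finset.range (N + 1), Real.exp (l ^ 2 * (1 + δ) / 2) :=
          Finset.prod_le_prod (fun i _ => mgf_nonneg)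
            fun i _ => mgf_le_exp_of_forall_abs_le (hY i) (hc i) (h0 i) (h1 i) hl hlc hδ
      _ = _ := by simp
  have hint : Integrable (fun ω => Real.exp (l * ∑ i ∈ Finset.range (N + 1), Y i ω)) P :=
    hsub.integrable N
  have hreal : Real.exp (l * x) * P.real A ≤
      ∫ ω, Real.exp (l * ∑ i ∈ Finset.range (N + 1), Y i ω) ∂P := by
    have h2 := ENNReal.toReal_mono ENNReal.ofReal_ne_top hmax
    rw [ENNReal.toReal_mul, ENNReal.toReal_ofReal
      (integral_nonneg fun ω => (Real.exp_pos _).le)] at h2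
    refine h2.trans ?_
    exact setIntegral_le_integral hint (ae_of_all _ fun ω => (Real.exp_pos _).le)
  calc _ ≤ P.real A := measureReal_mono hAsub
    _ = Real.exp (-(l * x)) * (Real.exp (l * x) * P.real A) := by
        rw [← mul_assoc, ← Real.exp_add]; simp
    _ ≤ Real.exp (-(l * x)) * Real.exp ((N + 1 : ℕ) * (l ^ 2 * (1 + δ) / 2)) := by
        gcongr; exact hreal.trans hmgf
    _ = _ := by rw [← Real.exp_add]

theorem ae_eventually_notMem_of_summable_measureReal {A : ℕ → Set Ω}
    (h : Summable fun k => P.real (A k)) : ∀ᵐ ω ∂P, ∀ᶠ k in atTop, ω ∉ A k := by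
  refine ae_eventually_notMem ?_
  have : ∀ k, P (A k) = ENNReal.ofReal (P.real (A k)) := fun k => by simp
  simp_rw [this]
  exact h.tsum_ofReal_ne_top

end

/-! ### Upper half of the law of the iterated logarithm -/

/-- Under geometric growth the last term below x dominates: all the terms up to it sum to at most r
/ (r - 1) times it. -/
theorem sum_range_indicator_lt_le {d : ℕ → ℝ} (hd : ∀ k, 0 ≤ d k) {r : ℝ} (hr : 1 < r)
    {K : ℕ} (hK : ∀ k ≥ K, r * d k ≤ d (k + 1)) (x : ℝ) (hx : 0 ≤ x) (n : ℕ) :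
    ∑ k ∈ Finset.range n, (if d (K + k) < x then d (K + k) else 0) ≤ r / (r - 1) * x := by
  have hr1 : 0 < r - 1 := by linarith
  have key : ∀ n, ∑ k ∈ Finset.range (n + 1), d (K + k) ≤ r / (r - 1) * d (K + n) := by
    intro n
    induction n with
    | zero =>
      have : 1 ≤ r / (r - 1) := by rw [le_div_iff₀ hr1]; linarith
      simpa using le_mul_of_one_le_left (hd K) this
    | succ n ih =>
      rw [Finset.sum_range_succ]
      have h1 := hK (K + n) (by omega)
      rw [← add_assoc]
      have h2 : r / (r - 1) * d (K + n) ≤ 1 / (r - 1) * d (K + n + 1) := by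
        calc _ = 1 / (r - 1) * (r * d (K + n)) := by ring
          _ ≤ _ := by gcongr
      have h3 : r / (r - 1) = 1 / (r - 1) + 1 := by field_simp; ring
      rw [h3, add_mul]
      linarith
  induction n with
  | zero => simp; positivity
  | succ n ih =>
    by_cases h : d (K + n) < x
    · calc _ ≤ ∑ k ∈ Finset.range (n + 1), d (K + k) := by
            refine Finset.sum_le_sum fun k _ => ?_
            split_ifs
            exacts [le_rfl, hd _]
        _ ≤ r / (r - 1) * d (K + n) := key n
        _ ≤ _ := by gcongr
    · rw [Finset.sum_range_succ, if_neg h, add_zero]; exact ih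

/-- The shift c is there to take the value log log ρ, which appears in log log (ρ ^ j) = log j + log
log ρ. -/
theorem eventually_log_succ_le {ε : ℝ} (hε : 0 < ε) (c : ℝ) :
    ∀ᶠ j : ℕ in atTop, Real.log (j + 1) ≤ (1 + ε) * (Real.log j + c) := by
  have h1 : Tendsto (fun j : ℕ => ε * Real.log j) atTop atTop :=
    (Real.tendsto_log_atTop.comp tendsto_natCast_atTop_atTop).const_mul_atTop hε
  filter_upwards [h1.eventually_ge_atTop (Real.log 2 - (1 + ε) * c), eventually_ge_atTop 1]
    with j hj hj1
  have hj1' : (1 : ℝ) ≤ j := by exact_mod_cast hj1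
  have h2 : Real.log (j + 1) ≤ Real.log (2 * j) := Real.log_le_log (by positivity) (by linarith)
  rw [Real.log_mul (by norm_num) (by positivity)] at h2
  linarith

/-- The squared ratio of consecutive terms is ρ log k / log (k + 1), eventually at least √ρ; hence r
= ρ^(1/4). -/
theorem exists_forall_mul_sqrt_pow_div_log_le {ρ : ℝ} (hρ : 1 < ρ) :
    ∃ r : ℝ, 1 < r ∧ ∃ K : ℕ, ∀ k ≥ K,
      r * √(ρ ^ k / Real.log k) ≤ √(ρ ^ (k + 1) / Real.log (k + 1 : ℕ)) := by
  have h1 : 1 < √ρ := Real.lt_sqrt_of_sq_lt (by simpa)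
  have hρ0 : 0 < ρ := by linarith
  obtain ⟨K, hK⟩ := ((eventually_log_succ_le (sub_pos.2 h1) 0).and
    (eventually_ge_atTop 2)).exists_forall_of_atTop
  refine ⟨√√ρ, Real.lt_sqrt_of_sq_lt (by simpa), K, fun k hk => ?_⟩
  obtain ⟨h2, h3⟩ := hK k hk
  have h3' : (2 : ℝ) ≤ k := by exact_mod_cast h3
  have hlog : 0 < Real.log k := Real.log_pos (by linarith)
  have hlog' : 0 < Real.log (k + 1) := Real.log_pos (by linarith)
  rw [← Real.sqrt_mul (Real.sqrt_nonneg _)]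
  refine Real.sqrt_le_sqrt ?_
  push_cast
  rw [mul_div_assoc', div_le_div_iff₀ hlog hlog', pow_succ]
  have h4 : √ρ * √ρ = ρ := Real.mul_self_sqrt hρ0.le
  have h5 : √ρ * Real.log (k + 1) ≤ ρ * Real.log k := by
    calc _ ≤ √ρ * (√ρ * Real.log k) := by gcongr; simpa using h2
      _ = _ := by rw [← mul_assoc, h4]
  calc _ = ρ ^ k * (√ρ * Real.log (k + 1)) := by ring
    _ ≤ ρ ^ k * (ρ * Real.log k) := by gcongr
    _ = _ := by ring

section

variable {Ω : Type*} [MeasurableSpace Ω] {P : Measure Ω} [IsProbabilityMeasure P]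

/-- Exchange sum and integral: for each ω the sum of the d k with τ d k < |Z| is at most a constant
times |Z| / τ beyond K, so the total is bounded by a multiple of E Z². This is why a finite second
moment suffices. -/
theorem summable_mul_integral_tail {Z : Ω → ℝ} (hZ : Measurable Z)
    (hZ2 : Integrable (fun ω => Z ω ^ 2) P) {d : ℕ → ℝ} (hd : ∀ k, 0 ≤ d k) {r : ℝ} (hr : 1 < r)
    {K : ℕ} (hK : ∀ k ≥ K, r * d k ≤ d (k + 1)) {τ : ℝ} (hτ : 0 < τ) :
    Summable fun k => d k * ∫ ω, (if τ * d k < |Z ω| then |Z ω| else 0) ∂P := by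
  have hZint : Integrable (fun ω => |Z ω|) P :=
    (((memLp_two_iff_integrable_sq hZ.aestronglyMeasurable).2 hZ2).integrable
      (by norm_num)).abs
  have hint (a : ℝ) : Integrable (fun ω => if a < |Z ω| then |Z ω| else 0) P := by
    refine hZint.mono' (Measurable.aestronglyMeasurable ?_) (ae_of_all _ fun ω => ?_)
    · exact Measurable.ite (measurableSet_lt measurable_const (by fun_prop)) (by fun_prop)
        measurable_const
    · split_ifs <;> simp
  rw [← summable_nat_add_iff K]
  refine summable_of_sum_range_le (c := ∫ ω, r / (r - 1) / τ * Z ω ^ 2 ∂P) (fun k => ?_)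
    fun n => ?_
  · refine mul_nonneg (hd _) (integral_nonneg fun ω => ?_)
    simp only [Pi.zero_apply]
    split_ifs <;> simp
  · simp_rw [← integral_const_mul]
    rw [← integral_finsetSum _ fun k _ => (hint _).const_mul _]
    refine integral_mono (integrable_finsetSum _ fun k _ => (hint _).const_mul _)
      (hZ2.const_mul _) fun ω => ?_
    have h := sum_range_indicator_lt_le hd hr hK (|Z ω| / τ) (by positivity) n
    calc _ = |Z ω| * ∑ k ∈ Finset.range n,
          (if d (K + k) < |Z ω| / τ then d (K + k) else 0) := by
          rw [Finset.mul_sum]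
          refine Finset.sum_congr rfl fun k _ => ?_
          simp only [lt_div_iff₀' hτ, add_comm K k]
          split_ifs <;> ring
      _ ≤ |Z ω| * (r / (r - 1) * (|Z ω| / τ)) := by gcongr
      _ = r / (r - 1) / τ * |Z ω| ^ 2 := by ring
      _ = _ := by rw [sq_abs]

/-- Each X i is at most its centred truncation, plus the truncated mean m, plus the discarded |X i|.
The budget (1 + 3ε)b splits as (1 + ε)b for the maximal inequality, εb for the drift N|m|, and εb
for the discarded part via Markov. -/
theorem measureReal_exists_le_sum_le_of_truncation {X : ℕ → Ω → ℝ} (hX : ∀ i, Measurable (X i))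
    (hind : iIndepFun X P) (hid : ∀ i, IdentDistrib (X i) (X 0) P P)
    (hX2 : Integrable (fun ω => X 0 ω ^ 2) P) (h0 : ∫ ω, X 0 ω ∂P = 0)
    (h1 : ∫ ω, X 0 ω ^ 2 ∂P = 1) {c l b ε : ℝ} (hc : 0 ≤ c) (hl : 0 ≤ l) (hb : 0 < b)
    (hε : 0 < ε) (hε1 : ε ≤ 1) (hlc : l * (2 * c) ≤ ε) (N : ℕ)
    (hN : N * ∫ ω, (if c < |X 0 ω| then |X 0 ω| else 0) ∂P ≤ ε * b) :
    P.real {ω | ∃ n ≤ N, (1 + 3 * ε) * b ≤ ∑ i ∈ Finset.range n, X i ω} ≤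
      Real.exp (-(l * ((1 + ε) * b)) + N * (l ^ 2 * (1 + ε) / 2)) +
        N * (∫ ω, (if c < |X 0 ω| then |X 0 ω| else 0) ∂P) / (ε * b) := by
  set r := ∫ ω, (if c < |X 0 ω| then |X 0 ω| else 0) ∂P
  have hTm : Measurable fun x : ℝ => if c < |x| then (0 : ℝ) else x :=
    Measurable.ite (measurableSet_lt measurable_const (by fun_prop)) measurable_const measurable_id
  have hRm : Measurable fun x : ℝ => if c < |x| then |x| else 0 :=
    Measurable.ite (measurableSet_lt measurable_const (by fun_prop)) (by fun_prop)
      measurable_const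
  set T : ℝ → ℝ := fun x => if c < |x| then 0 else x
  set R : ℝ → ℝ := fun x => if c < |x| then |x| else 0
  have hTc (x : ℝ) : |T x| ≤ c := by
    simp only [T]; split_ifs with h
    · simpa using hc
    · exact not_lt.1 h
  have hTsq (x : ℝ) : T x ^ 2 ≤ x ^ 2 := by
    simp only [T]; split_ifs
    · simpa using sq_nonneg x
    · rfl
  have hR0 (x : ℝ) : 0 ≤ R x := by simp only [R]; split_ifs <;> simp
  have hTR (x : ℝ) : |x - T x| = R x := by simp only [T, R]; split_ifs <;> simp
  have hX1 : Integrable (X 0) P :=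
    ((memLp_two_iff_integrable_sq (hX 0).aestronglyMeasurable).2 hX2).integrable (by norm_num)
  have hTint : Integrable (fun ω => T (X 0 ω)) P :=
    integrable_of_forall_abs_le (hTm.comp (hX 0)) fun ω => hTc _
  have hTint2 : Integrable (fun ω => T (X 0 ω) ^ 2) P :=
    integrable_of_forall_abs_le ((hTm.comp (hX 0)).pow_const 2) (c := c ^ 2) fun ω => by
      rw [abs_pow]; gcongr; exact hTc _
  have hRint : Integrable (fun ω => R (X 0 ω)) P := by
    refine (hX1.sub hTint).abs.congr (ae_of_all _ fun ω => ?_)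
    simp [hTR]
  set m := ∫ ω, T (X 0 ω) ∂P
  -- As E X = 0, the mean of the kept part is minus the mean of the discarded part.
  have hm : |m| ≤ r := by
    have : m = -∫ ω, (X 0 ω - T (X 0 ω)) ∂P := by rw [integral_sub hX1 hTint, h0]; simp [m]
    rw [this, abs_neg]
    refine (abs_integral_le_integral_abs).trans (le_of_eq ?_)
    simp only [hTR, r, R]
  have hmc : |m| ≤ c := by
    have := norm_integral_le_of_norm_le_const (μ := P) (f := fun ω => T (X 0 ω)) (C := c)
      (ae_of_all _ fun ω => hTc _)
    simpa using this
  set Y : ℕ → Ω → ℝ := fun i ω => T (X i ω) - m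
  have hgm : Measurable fun x => T x - m := hTm.sub_const m
  have hYm (i : ℕ) : Measurable (Y i) := hgm.comp (hX i)
  have hYid (i : ℕ) : IdentDistrib (Y i) (Y 0) P P := (hid i).comp hgm
  have hYind : iIndepFun Y P := hind.comp (fun _ x => T x - m) fun _ => hgm
  have hYc (i : ℕ) (ω : Ω) : |Y i ω| ≤ 2 * c :=
    (abs_sub _ _).trans (by linarith [hTc (X i ω)])
  have hY0 (i : ℕ) : ∫ ω, Y i ω ∂P = 0 := by
    rw [(hYid i).integral_eq, integral_sub hTint (integrable_const _)]; simp [m]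
  have hY1 (i : ℕ) : ∫ ω, Y i ω ^ 2 ∂P ≤ 1 := by
    have e : IdentDistrib (fun ω => Y i ω ^ 2) (fun ω => Y 0 ω ^ 2) P P :=
      (hYid i).comp (measurable_id.pow_const 2)
    rw [e.integral_eq]
    have e2 : ∫ ω, Y 0 ω ^ 2 ∂P = ∫ ω, T (X 0 ω) ^ 2 ∂P - m ^ 2 := by
      have : ∀ ω, Y 0 ω ^ 2 = T (X 0 ω) ^ 2 - (2 * m * T (X 0 ω) - m ^ 2) := fun ω => by
        simp only [Y]; ring
      simp_rw [this]
      have hlin : Integrable (fun ω => 2 * m * T (X 0 ω) - m ^ 2) P :=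
        (hTint.const_mul _).sub (integrable_const _)
      rw [integral_sub hTint2 hlin, integral_sub (hTint.const_mul _) (integrable_const _),
        integral_const_mul]
      simp [m]; ring
    rw [e2]
    have : ∫ ω, T (X 0 ω) ^ 2 ∂P ≤ ∫ ω, X 0 ω ^ 2 ∂P := integral_mono hTint2 hX2 fun ω => hTsq _
    nlinarith [sq_nonneg m]
  have hsub : {ω | ∃ n ≤ N, (1 + 3 * ε) * b ≤ ∑ i ∈ Finset.range n, X i ω} ⊆
      {ω | ∃ n ≤ N, (1 + ε) * b ≤ ∑ i ∈ Finset.range n, Y i ω} ∪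
        {ω | ε * b ≤ ∑ i ∈ Finset.range N, R (X i ω)} := by
    rintro ω ⟨n, hn, hω⟩
    by_contra hcon
    simp only [Set.mem_union, Set.mem_ofPred_eq, not_or, not_exists, not_and, not_le] at hcon
    have hA := hcon.1 n hn
    have hB := hcon.2
    have h2 : ∑ i ∈ Finset.range n, R (X i ω) ≤ ∑ i ∈ Finset.range N, R (X i ω) :=
      Finset.sum_le_sum_of_subset_of_nonneg (Finset.range_mono hn) fun i _ _ => hR0 _
    have h3 : ∑ i ∈ Finset.range n, X i ω ≤
        ∑ i ∈ Finset.range n, Y i ω + n * m + ∑ i ∈ Finset.range n, R (X i ω) := by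
      have : (n : ℝ) * m = ∑ i ∈ Finset.range n, m := by simp
      rw [this, ← Finset.sum_add_distrib, ← Finset.sum_add_distrib]
      refine Finset.sum_le_sum fun i _ => ?_
      have := (abs_le.1 (hTR (X i ω)).le).2
      simp only [Y]
      linarith
    have h4 : (n : ℝ) * m ≤ N * r := by
      have : (n : ℝ) ≤ N := by exact_mod_cast hn
      calc (n : ℝ) * m ≤ n * r := by gcongr; linarith [le_abs_self m]
        _ ≤ N * r := mul_le_mul_of_nonneg_right this ((abs_nonneg m).trans hm)
    linarith
  refine (measureReal_mono hsub).trans ((measureReal_union_le _ _).trans (add_le_add ?_ ?_))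
  · exact measureReal_exists_le_sum_le hYm hYind hYc hY0 hY1 hl hlc hε1 (by positivity) N
  · have hRid (i : ℕ) : IdentDistrib (fun ω => R (X i ω)) (fun ω => R (X 0 ω)) P P :=
      (hid i).comp hRm
    have hRint' (i : ℕ) : Integrable (fun ω => R (X i ω)) P := (hRid i).integrable_iff.2 hRint
    have h5 := mul_meas_ge_le_integral_of_nonneg (μ := P)
      (f := fun ω => ∑ i ∈ Finset.range N, R (X i ω))
      (ae_of_all _ fun ω => Finset.sum_nonneg fun i _ => hR0 _)
      (integrable_finsetSum _ fun i _ => hRint' i) (ε * b)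
    rw [integral_finsetSum _ fun i _ => hRint' i] at h5
    simp_rw [fun i => (hRid i).integral_eq] at h5
    rw [le_div_iff₀ (by positivity), mul_comm]
    simpa [r, R] using h5

/-- First Borel-Cantelli lemma: the exceptional events have probability at most k^(-(1+ε)) + d k * R
k / ε, and both terms are summable. -/
theorem ae_eventually_forall_le_pow_sum_lt {X : ℕ → Ω → ℝ} (hX : ∀ i, Measurable (X i))
    (hind : iIndepFun X P) (hid : ∀ i, IdentDistrib (X i) (X 0) P P)
    (hX2 : Integrable (fun ω => X 0 ω ^ 2) P) (h0 : ∫ ω, X 0 ω ∂P = 0)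
    (h1 : ∫ ω, X 0 ω ^ 2 ∂P = 1) {ρ ε : ℝ} (hρ : 1 < ρ) (hε : 0 < ε) (hε1 : ε ≤ 1) :
    ∀ᵐ ω ∂P, ∀ᶠ k : ℕ in atTop, ∀ n : ℕ, (n : ℝ) ≤ ρ ^ k →
      ∑ i ∈ Finset.range n, X i ω < (1 + 3 * ε) * √(2 * ρ ^ k * Real.log k) := by
  have hρ0 : 0 < ρ := by linarith
  set d : ℕ → ℝ := fun k => √(ρ ^ k / Real.log k)
  obtain ⟨r, hr, K, hK⟩ := exists_forall_mul_sqrt_pow_div_log_le hρ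
  set R : ℕ → ℝ := fun k =>
    ∫ ω, (if ε / 4 * d k < |X 0 ω| then |X 0 ω| else 0) ∂P
  have hsum : Summable fun k => d k * R k :=
    summable_mul_integral_tail (hX 0) hX2 (d := d) (fun k => Real.sqrt_nonneg _) hr hK
      (τ := ε / 4) (by positivity)
  have hR0 (k : ℕ) : 0 ≤ R k := integral_nonneg fun ω => by
    simp only [Pi.zero_apply]; split_ifs <;> simp
  set N : ℕ → ℕ := fun k => ⌊ρ ^ k⌋₊
  have hN (k : ℕ) : (N k : ℝ) ≤ ρ ^ k := Nat.floor_le (by positivity)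
  set A : ℕ → Set Ω := fun k => {ω | ∃ n ≤ N k,
    (1 + 3 * ε) * √(2 * ρ ^ k * Real.log k) ≤ ∑ i ∈ Finset.range n, X i ω}
  have hA : ∀ᶠ k in atTop,
      P.real (A k) ≤ (k : ℝ) ^ (-(1 + ε)) + d k * R k / ε := by
    filter_upwards [eventually_ge_atTop 2,
      hsum.tendsto_atTop_zero.eventually_le_const hε] with k hk hkε
    have hk' : (2 : ℝ) ≤ k := by exact_mod_cast hk
    have hL : 0 < Real.log k := Real.log_pos (by linarith)
    have hρk : 0 < ρ ^ k := by positivity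
    set L := Real.log k
    set b := √(2 * ρ ^ k * L)
    -- The minimizer b / ρ^k of -l b + ρ^k l² / 2, making the exponent -(1 + ε) log k. Since l * d k
    -- = √2, truncation at (ε / 4) d k satisfies l * 2c ≤ ε.
    set l := √(2 * L / ρ ^ k)
    have hb : 0 < b := by positivity
    have hlb : l * b = 2 * L := by
      rw [← Real.sqrt_mul (by positivity)]
      rw [show 2 * L / ρ ^ k * (2 * ρ ^ k * L) = (2 * L) ^ 2 by field_simp]
      exact Real.sqrt_sq (by positivity)
    have hld : l * d k = √2 := by
      rw [← Real.sqrt_mul (by positivity)]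
      congr 1
      simp only [L] at hL ⊢
      field_simp
    have hl2 : ρ ^ k * l ^ 2 = 2 * L := by
      rw [Real.sq_sqrt (by positivity)]; field_simp
    have hdb : √2 * ρ ^ k = d k * b := by
      rw [← Real.sqrt_mul (by positivity),
        show ρ ^ k / Real.log k * (2 * ρ ^ k * L) = 2 * (ρ ^ k) ^ 2 by
          simp only [L] at hL ⊢; field_simp, Real.sqrt_mul (by norm_num),
        Real.sqrt_sq (by positivity)]
    have h2 : 1 ≤ √2 := Real.one_le_sqrt.2 (by norm_num)
    have h2' : √2 ≤ 2 := Real.sqrt_le_iff.2 (by norm_num)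
    have hNR : N k * R k ≤ d k * R k * b := by
      calc N k * R k ≤ √2 * ρ ^ k * R k := by
            refine mul_le_mul_of_nonneg_right ?_ (hR0 k)
            exact (hN k).trans (le_mul_of_one_le_left hρk.le h2)
        _ = _ := by rw [hdb]; ring
    refine (measureReal_exists_le_sum_le_of_truncation hX hind hid hX2 h0 h1
      (c := ε / 4 * d k) (l := l) (b := b) (by positivity) (by positivity) hb hε hε1 ?_ (N k)
      ?_).trans (add_le_add ?_ ?_)
    · calc l * (2 * (ε / 4 * d k)) = ε / 2 * (l * d k) := by ring
        _ ≤ ε / 2 * 2 := by rw [hld]; gcongr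
        _ = ε := by ring
    · exact hNR.trans (by gcongr)
    · rw [Real.rpow_def_of_pos (by linarith), Real.exp_le_exp]
      have : N k * (l ^ 2 * (1 + ε) / 2) ≤ ρ ^ k * (l ^ 2 * (1 + ε) / 2) := by
        gcongr; exact hN k
      have e1 : ρ ^ k * (l ^ 2 * (1 + ε) / 2) = L * (1 + ε) := by
        linear_combination (1 + ε) / 2 * hl2
      have e2 : l * ((1 + ε) * b) = 2 * L * (1 + ε) := by
        linear_combination (1 + ε) * hlb
      simp only [L] at *
      linarith
    · rw [div_le_div_iff₀ (by positivity) hε]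
      calc _ = (N k * R k) * ε := rfl
        _ ≤ d k * R k * b * ε := by gcongr
        _ = _ := by ring
  have hsumA : Summable fun k => P.real (A k) := by
    refine Summable.of_norm_bounded_eventually_nat
      ((Real.summable_nat_rpow (p := -(1 + ε))|>.2 (by linarith)).add (hsum.div_const ε)) ?_
    filter_upwards [hA] with k hk
    rwa [Real.norm_of_nonneg measureReal_nonneg]
  filter_upwards [ae_eventually_notMem_of_summable_measureReal hsumA] with ω hω
  filter_upwards [hω] with k hk n hn
  by_contra hcon
  exact hk ⟨n, Nat.le_floor hn, not_lt.1 hcon⟩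

theorem ae_eventually_sum_le {X : ℕ → Ω → ℝ} (hX : ∀ i, Measurable (X i))
    (hind : iIndepFun X P) (hid : ∀ i, IdentDistrib (X i) (X 0) P P)
    (hX2 : Integrable (fun ω => X 0 ω ^ 2) P) (h0 : ∫ ω, X 0 ω ∂P = 0)
    (h1 : ∫ ω, X 0 ω ^ 2 ∂P = 1) {η : ℝ} (hη : 0 < η) :
    ∀ᵐ ω ∂P, ∀ᶠ n : ℕ in atTop,
      ∑ i ∈ Finset.range n, X i ω ≤ (1 + η) * √(2 * n * Real.log (Real.log n)) := by
  -- For ε ≤ 1, (1 + 3ε)(1 + ε) = 1 + 4ε + 3ε² ≤ 1 + 7ε.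
  obtain ⟨ε, hε, hε1, hεη⟩ : ∃ ε : ℝ, 0 < ε ∧ ε ≤ 1 ∧ (1 + 3 * ε) * (1 + ε) ≤ 1 + η := by
    refine ⟨min 1 (η / 7), by positivity, min_le_left _ _, ?_⟩
    have h1 : min 1 (η / 7) ≤ 1 := min_le_left _ _
    have h2 : min 1 (η / 7) ≤ η / 7 := min_le_right _ _
    have h3 : 0 < min 1 (η / 7) := by positivity
    nlinarith
  -- With ρ^j ≤ n < ρ^(j+1), passing from ρ^(j+1) to n costs a factor 1 + ε, and passing from log (j
  -- + 1) to log log n costs another; under the square root they combine to 1 + ε.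
  set ρ := 1 + ε
  have hρ : 1 < ρ := by simp [ρ, hε]
  have hlogρ : 0 < Real.log ρ := Real.log_pos hρ
  filter_upwards [ae_eventually_forall_le_pow_sum_lt hX hind hid hX2 h0 h1 hρ hε hε1] with ω hω
  obtain ⟨K, hK⟩ := (((tendsto_add_atTop_nat 1).eventually hω).and
    ((eventually_log_succ_le hε (Real.log (Real.log ρ))).and
      (eventually_ge_atTop 1))).exists_forall_of_atTop
  filter_upwards [(tendsto_natCast_atTop_atTop (R := ℝ)).eventually_ge_atTop (ρ ^ K),
    eventually_ge_atTop 1] with n hn hn1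
  have hn1' : (1 : ℝ) ≤ n := by exact_mod_cast hn1
  obtain ⟨j, hj1, hj2⟩ := exists_nat_pow_near hn1' hρ
  have hjK : K ≤ j := by
    have : ρ ^ K < ρ ^ (j + 1) := hn.trans_lt hj2
    have := (pow_lt_pow_iff_right₀ hρ).1 this
    omega
  obtain ⟨h2, h3, h4⟩ := hK j hjK
  have h4' : (1 : ℝ) ≤ j := by exact_mod_cast h4
  have h5 : Real.log j + Real.log (Real.log ρ) ≤ Real.log (Real.log n) := by
    rw [← Real.log_mul (by positivity) (by positivity), ← Real.log_pow]
    refine Real.log_le_log (Real.log_pos (one_lt_pow₀ hρ (by omega))) ?_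
    exact Real.log_le_log (by positivity) hj1
  have h6 : √(2 * ρ ^ (j + 1) * Real.log (j + 1 : ℕ)) ≤
      (1 + ε) * √(2 * n * Real.log (Real.log n)) := by
    rw [← Real.sqrt_sq (show (0 : ℝ) ≤ 1 + ε by linarith), ← Real.sqrt_mul (by positivity)]
    refine Real.sqrt_le_sqrt ?_
    push_cast
    have h7 : Real.log (j + 1) ≤ (1 + ε) * Real.log (Real.log n) :=
      h3.trans (by gcongr)
    calc 2 * ρ ^ (j + 1) * Real.log (j + 1)
        ≤ 2 * ρ ^ (j + 1) * ((1 + ε) * Real.log (Real.log n)) := by gcongr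
      _ = 2 * ρ ^ j * ((1 + ε) * ((1 + ε) * Real.log (Real.log n))) := by
          rw [pow_succ]; ring
      _ ≤ 2 * n * ((1 + ε) * ((1 + ε) * Real.log (Real.log n))) := by
          have : 0 ≤ (1 + ε) * Real.log (Real.log n) :=
            (Real.log_nonneg (by linarith)).trans h7
          gcongr
      _ = _ := by ring
  calc _ ≤ (1 + 3 * ε) * √(2 * ρ ^ (j + 1) * Real.log (j + 1 : ℕ)) := (h2 n hj2.le).le
    _ ≤ (1 + 3 * ε) * ((1 + ε) * √(2 * n * Real.log (Real.log n))) := by gcongr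
    _ = (1 + 3 * ε) * (1 + ε) * √(2 * n * Real.log (Real.log n)) := by ring
    _ ≤ _ := by gcongr

end

/-! ### Lower half of the law of the iterated logarithm -/

/-- Bound the tail below by the density at u + 1 over the unit interval (u, u + 1]. The loss in the
exponent is linear in u, and η u² / 2 absorbs it for large u. -/
theorem exists_exp_lt_gaussianReal_Ioi {η : ℝ} (hη : 0 < η) :
    ∃ u : ℝ, 0 < u ∧
      ENNReal.ofReal (Real.exp (-((1 + η) * u ^ 2 / 2))) < gaussianReal 0 1 (Set.Ioi u) := by
  set C := Real.log (√(2 * Real.pi))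
  obtain ⟨u, hu0, hu⟩ : ∃ u : ℝ, 0 < u ∧ 0 < η / 2 * u ^ 2 - u - (1 / 2 + C) := by
    have h1 : Tendsto (fun u : ℝ => u * (η / 2 * u - 1)) atTop atTop :=
      tendsto_id.atTop_mul_atTop₀
        (tendsto_atTop_add_const_right _ _ (tendsto_id.const_mul_atTop (by positivity)))
    obtain ⟨u, hu, hu0⟩ := ((h1.eventually_gt_atTop (1 / 2 + C)).and
      (eventually_gt_atTop 0)).exists
    exact ⟨u, hu0, by nlinarith⟩
  refine ⟨u, hu0, ?_⟩
  have hexp : Real.exp (-((1 + η) * u ^ 2 / 2)) <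
      (√(2 * Real.pi))⁻¹ * Real.exp (-(u + 1) ^ 2 / 2) := by
    have : (√(2 * Real.pi))⁻¹ = Real.exp (-C) := by
      rw [Real.exp_neg, Real.exp_log (by positivity)]
    rw [this, ← Real.exp_add, Real.exp_lt_exp]
    nlinarith
  calc _ < ENNReal.ofReal ((√(2 * Real.pi))⁻¹ * Real.exp (-(u + 1) ^ 2 / 2)) :=
        (ENNReal.ofReal_lt_ofReal_iff (by positivity)).2 hexp
    _ = ∫⁻ x in Set.Ioc u (u + 1),
          ENNReal.ofReal ((√(2 * Real.pi))⁻¹ * Real.exp (-(u + 1) ^ 2 / 2)) := by simp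
    _ ≤ ∫⁻ x in Set.Ioc u (u + 1), gaussianPDF 0 1 x := by
        refine setLIntegral_mono (by fun_prop) fun x hx => ENNReal.ofReal_le_ofReal ?_
        simp only [gaussianPDFReal, NNReal.coe_one, mul_one, sub_zero]
        have h1 : x ^ 2 ≤ (u + 1) ^ 2 := by
          have := hx.1; have := hx.2
          gcongr
          linarith
        gcongr
    _ = gaussianReal 0 1 (Set.Ioc u (u + 1)) := (gaussianReal_apply 0 one_ne_zero _).symm
    _ ≤ _ := measure_mono Set.Ioc_subset_Ioi_self

theorem identDistrib_sum_range_add {Ω : Type*} [MeasurableSpace Ω] {P : Measure Ω}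
    {X : ℕ → Ω → ℝ} (hind : iIndepFun X P)
    (hid : ∀ i, IdentDistrib (X i) (X 0) P P) (a n : ℕ) :
    IdentDistrib (fun ω => ∑ i ∈ Finset.range n, X (a + i) ω)
      (fun ω => ∑ i ∈ Finset.range n, X i ω) P P :=
  (IdentDistrib.pi (X := fun i => X (a + i)) (Y := X) (fun i => (hid _).trans (hid i).symm)
    (hind.precomp (add_right_injective a)) hind).comp
    (u := fun x : ℕ → ℝ => ∑ i ∈ Finset.range n, x i) (by fun_prop)

theorem indep_iSup_comap_of_disjoint {Ω : Type*} [MeasurableSpace Ω] {P : Measure Ω}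
    {X : ℕ → Ω → ℝ} (hX : ∀ i, Measurable (X i))
    (hind : iIndepFun X P) {S T : Set ℕ} (hST : Disjoint S T) :
    Indep (⨆ i ∈ S, MeasurableSpace.comap (X i) inferInstance)
      (⨆ i ∈ T, MeasurableSpace.comap (X i) inferInstance) P :=
  indep_iSup_of_disjoint (fun i => (hX i).comap_le) ((iIndepFun_iff_iIndep _ _ _).1 hind) hST

theorem measurableSet_le_sum_of_subset {Ω : Type*} (X : ℕ → Ω → ℝ) {s : Finset ℕ}
    {S : Set ℕ} (hs : ∀ i ∈ s, i ∈ S) (c : ℝ) :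
    MeasurableSet[⨆ i ∈ S, MeasurableSpace.comap (X i) inferInstance]
      {ω | c ≤ ∑ i ∈ s, X i ω} := by
  have h : Measurable[⨆ i ∈ S, MeasurableSpace.comap (X i) inferInstance]
      (fun ω => ∑ i ∈ s, X i ω) :=
    Finset.measurable_fun_sum _ fun i hi => (comap_measurable (X i)).mono
      (le_iSup₂_of_le i (hs i hi) le_rfl) le_rfl
  exact h measurableSet_Ici

theorem log_log_le_of_pow_le {ρ δ : ℝ} (hρ : 1 < ρ) {k : ℕ} (hk : k ≠ 0)
    (h : Real.log (k + 1 : ℕ) + Real.log (Real.log ρ) ≤ (1 + δ) * Real.log k) {x : ℝ}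
    (hx : ρ ^ k ≤ x) (hx' : x ≤ ρ ^ (k + 1)) :
    Real.log (Real.log x) ≤ (1 + δ) * Real.log k := by
  have hx1 : 1 < x := (one_lt_pow₀ hρ hk).trans_le hx
  calc Real.log (Real.log x) ≤ Real.log (Real.log (ρ ^ (k + 1))) :=
        Real.log_le_log (Real.log_pos hx1) (Real.log_le_log (by linarith) hx')
    _ = Real.log (k + 1 : ℕ) + Real.log (Real.log ρ) := by
        rw [Real.log_pow, Real.log_mul (by positivity) (Real.log_pos hρ).ne']
    _ ≤ _ := h

theorem sqrt_mul_le_of_le {x y z δ : ℝ} (hx : 0 ≤ x) (hδ : 0 ≤ δ) (hy : 0 ≤ y)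
    (hz : z ≤ (1 + δ) * y) : √(2 * x * z) ≤ (1 + δ) * √(2 * x * y) := by
  have h1 : 1 + δ ≤ (1 + δ) ^ 2 := by nlinarith
  rw [← Real.sqrt_sq (show 0 ≤ 1 + δ by linarith), ← Real.sqrt_mul (sq_nonneg _)]
  refine Real.sqrt_le_sqrt ?_
  calc 2 * x * z ≤ 2 * x * ((1 + δ) ^ 2 * y) := by
        gcongr; exact hz.trans (by gcongr)
    _ = _ := by ring

section

variable {Ω : Type*} [MeasurableSpace Ω] {P : Measure Ω} [IsProbabilityMeasure P]

/-- The central limit theorem, with the portmanteau inequality on an open half-line. One fixed u is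
enough: larger deviations come from concatenating blocks. -/
theorem exists_eventually_exp_le_measureReal_sum {X : ℕ → Ω → ℝ} (hX : ∀ i, Measurable (X i))
    (hind : iIndepFun X P) (hid : ∀ i, IdentDistrib (X i) (X 0) P P)
    (h0 : ∫ ω, X 0 ω ∂P = 0) (h1 : ∫ ω, X 0 ω ^ 2 ∂P = 1) {η : ℝ} (hη : 0 < η) :
    ∃ u : ℝ, 0 < u ∧ ∀ᶠ p : ℕ in atTop, Real.exp (-((1 + η) * u ^ 2 / 2)) ≤
      P.real {ω | u * √p ≤ ∑ i ∈ Finset.range p, X i ω} := by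
  obtain ⟨u, hu0, hu⟩ := exists_exp_lt_gaussianReal_Ioi hη
  refine ⟨u, hu0, ?_⟩
  have hY : HasLaw (id : ℝ → ℝ) (gaussianReal 0 1) (gaussianReal 0 1) :=
    ⟨aemeasurable_id, by simp⟩
  have hclt := tendstoInDistribution_inv_sqrt_mul_sum hY h0 (by simpa using h1) hind hid
  have hlim := ProbabilityMeasure.le_liminf_measure_open_of_tendsto hclt.tendsto
    (isOpen_Ioi (a := u))
  simp only [ProbabilityMeasure.coe_mk, Measure.map_id] at hlim
  filter_upwards [eventually_lt_of_lt_liminf (hu.trans_le hlim), eventually_ge_atTop 1]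
    with p hp hp1
  have hp1' : (0 : ℝ) < p := by exact_mod_cast hp1
  rw [Measure.map_apply (by fun_prop) measurableSet_Ioi] at hp
  refine (ENNReal.ofReal_le_iff_le_toReal (measure_ne_top _ _)).1 (hp.le.trans (measure_mono ?_))
  intro ω hω
  simp only [Set.mem_preimage, Set.mem_Ioi] at hω
  rw [← div_eq_inv_mul, lt_div_iff₀ (by positivity)] at hω
  exact hω.le

/-- If each of q consecutive blocks of length p sums to at least x, the whole sums to at least q x;
the blocks are independent with equal laws. -/
theorem pow_measureReal_le_measureReal_sum_mul {X : ℕ → Ω → ℝ} (hX : ∀ i, Measurable (X i))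
    (hind : iIndepFun X P) (hid : ∀ i, IdentDistrib (X i) (X 0) P P) (p : ℕ) (x : ℝ) (q : ℕ) :
    P.real {ω | x ≤ ∑ i ∈ Finset.range p, X i ω} ^ q ≤
      P.real {ω | q * x ≤ ∑ i ∈ Finset.range (p * q), X i ω} := by
  induction q with
  | zero => simp
  | succ q ih =>
    have hsplit (ω : Ω) : ∑ i ∈ Finset.range (p * (q + 1)), X i ω =
        ∑ i ∈ Finset.range (p * q), X i ω + ∑ i ∈ Finset.Ico (p * q) (p * q + p), X i ω := by
      rw [mul_add, mul_one, Finset.sum_range_add_sum_Ico _ (by omega)]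
    have hblock : P.real {ω | x ≤ ∑ i ∈ Finset.range p, X i ω} =
        P.real {ω | x ≤ ∑ i ∈ Finset.Ico (p * q) (p * q + p), X i ω} := by
      have := (identDistrib_sum_range_add hind hid (p * q) p).measure_mem_eq
        (s := Set.Ici x) measurableSet_Ici
      simp only [Finset.sum_Ico_eq_sum_range, add_tsub_cancel_left]
      exact congrArg ENNReal.toReal this.symm
    have hdis : Disjoint (Set.Iio (p * q)) (Set.Ici (p * q)) := by
      rw [Set.disjoint_left]; intro i hi hi'; simp at hi hi'; omega
    have hI := congrArg ENNReal.toReal <| (Indep_iff _ _ _).1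
      (indep_iSup_comap_of_disjoint hX hind hdis) _ _
      (measurableSet_le_sum_of_subset X (s := Finset.range (p * q)) (by simp) (q * x))
      (measurableSet_le_sum_of_subset X (s := Finset.Ico (p * q) (p * q + p))
        (fun i hi => (Finset.mem_Ico.1 hi).1) x)
    rw [ENNReal.toReal_mul] at hI
    calc _ ≤ P.real {ω | q * x ≤ ∑ i ∈ Finset.range (p * q), X i ω} *
          P.real {ω | x ≤ ∑ i ∈ Finset.Ico (p * q) (p * q + p), X i ω} := by
          rw [pow_succ, ← hblock]; gcongr
      _ = _ := hI.symm
      _ ≤ _ := by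
          refine measureReal_mono fun ω hω => ?_
          have h1 : q * x ≤ ∑ i ∈ Finset.range (p * q), X i ω := hω.1
          have h2 : x ≤ ∑ i ∈ Finset.Ico (p * q) (p * q + p), X i ω := hω.2
          change ((q + 1 : ℕ) : ℝ) * x ≤ _
          rw [hsplit]
          push_cast
          linarith

/-- Peel off the largest index m of a finite family: its event uses only indices from a m on, all
the others only indices below a m. -/
theorem iIndepSet_le_sum_Ico {X : ℕ → Ω → ℝ} (hX : ∀ i, Measurable (X i))
    (hind : iIndepFun X P) {a b : ℕ → ℕ} (ha : Monotone a) (hab : ∀ k, b k ≤ a (k + 1))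
    (c : ℕ → ℝ) :
    iIndepSet (fun k => {ω | c k ≤ ∑ i ∈ Finset.Ico (a k) (b k), X i ω}) P := by
  have hm (k : ℕ) : MeasurableSet {ω | c k ≤ ∑ i ∈ Finset.Ico (a k) (b k), X i ω} :=
    measurableSet_le measurable_const (by fun_prop)
  rw [iIndepSet_iff_meas_biInter hm]
  intro s
  induction s using Finset.induction_on_max with
  | empty => simp
  | insert m s hs ih =>
    have hms : m ∉ s := fun h => lt_irrefl _ (hs m h)
    rw [Finset.prod_insert hms, ← ih, Finset.set_biInter_insert]
    have hdis : Disjoint (Set.Ici (a m)) (Set.Iio (a m)) := by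
      rw [Set.disjoint_left]; intro i hi hi'; simp at hi hi'; omega
    refine (Indep_iff _ _ _).1 (indep_iSup_comap_of_disjoint hX hind hdis) _ _
      (measurableSet_le_sum_of_subset X (fun i hi => (Finset.mem_Ico.1 hi).1) _) ?_
    refine Finset.measurableSet_biInter _ fun k hk => measurableSet_le_sum_of_subset X
      (fun i hi => ?_) _
    have h1 := (Finset.mem_Ico.1 hi).2
    exact h1.trans_le ((hab k).trans (ha (hs k hk)))

theorem eventually_mul_natCast_le_pow (C : ℝ) {ρ : ℝ} (hρ : 1 < ρ) :
    ∀ᶠ k : ℕ in atTop, C * k ≤ ρ ^ k := by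
  have h := (tendsto_pow_const_div_const_pow_of_one_lt 1 hρ).const_mul C
  rw [mul_zero] at h
  filter_upwards [h.eventually_le_const one_pos] with k hk
  have : 0 < ρ ^ k := by positivity
  rwa [pow_one, mul_div_assoc', div_le_one this] at hk

theorem ae_frequently_le_sum_Ico_pow {X : ℕ → Ω → ℝ} (hX : ∀ i, Measurable (X i))
    (hind : iIndepFun X P) (hid : ∀ i, IdentDistrib (X i) (X 0) P P)
    (h0 : ∫ ω, X 0 ω ∂P = 0) (h1 : ∫ ω, X 0 ω ^ 2 ∂P = 1) {η : ℝ} (hη : 0 < η) (hη1 : η < 1)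
    {ρ : ℕ} (hρ : 2 ≤ ρ) :
    ∀ᵐ ω ∂P, ∃ᶠ k : ℕ in atTop, ∃ n : ℕ, ρ ^ k ≤ n ∧ n ≤ ρ ^ (k + 1) ∧
      (1 - η) * √(2 * ((ρ : ℝ) ^ (k + 1) - ρ ^ k) * Real.log k) ≤
        ∑ i ∈ Finset.Ico (ρ ^ k) n, X i ω := by
  have hρ1 : (2 : ℝ) ≤ ρ := by exact_mod_cast hρ
  obtain ⟨u, hu0, hu⟩ := exists_eventually_exp_le_measureReal_sum hX hind hid h0 h1 hη
  obtain ⟨p₀, hp₀⟩ := hu.exists_forall_of_atTop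
  -- The number of sub-blocks: small enough that exp(-q(1 + η)u² / 2) ≥ 1 / k, large enough that the
  -- level q u √p = √(q u² · p q) is nearly √(2 M log k).
  set q : ℕ → ℕ := fun k => ⌊2 * Real.log k / ((1 + η) * u ^ 2)⌋₊
  set M : ℕ → ℕ := fun k => ρ ^ (k + 1) - ρ ^ k
  set p : ℕ → ℕ := fun k => M k / q k
  have hMpow (k : ℕ) : ρ ^ k ≤ ρ ^ (k + 1) := Nat.pow_le_pow_right (by omega) (by omega)
  have hMcast (k : ℕ) : (M k : ℝ) = (ρ : ℝ) ^ (k + 1) - ρ ^ k := by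
    simp only [M]; rw [Nat.cast_sub (hMpow k)]; push_cast; rfl
  have hMge (k : ℕ) : (ρ : ℝ) ^ k ≤ M k := by
    rw [hMcast, pow_succ]
    have : 0 < (ρ : ℝ) ^ k := by positivity
    nlinarith
  have hlog0 (k : ℕ) : 0 ≤ Real.log k := Real.log_natCast_nonneg k
  have hqle (k : ℕ) : (q k : ℝ) ≤ 2 * Real.log k / ((1 + η) * u ^ 2) :=
    Nat.floor_le (by have := hlog0 k; positivity)
  have hqM (C : ℝ) (hC : 0 ≤ C) : ∀ᶠ k : ℕ in atTop, C * q k ≤ M k := by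
    filter_upwards [eventually_mul_natCast_le_pow (C * (2 / ((1 + η) * u ^ 2)))
      (show (1 : ℝ) < ρ by linarith)] with k hk
    refine (le_trans ?_ hk).trans (hMge k)
    rw [mul_assoc]
    gcongr
    refine (hqle k).trans ?_
    rw [mul_div_right_comm]
    gcongr
    exact Real.log_le_self (by positivity)
  have hlog : Tendsto (fun k : ℕ => Real.log k) atTop atTop :=
    Real.tendsto_log_atTop.comp tendsto_natCast_atTop_atTop
  have hqu : ∀ᶠ k : ℕ in atTop, (1 - η) * (2 * Real.log k) ≤ q k * u ^ 2 := by
    -- The gap between 1 / (1 + η) and 1 - η, times 2 log k, eventually exceeds the u² lost to the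
    -- floor in q.
    have hpos : 0 < 2 * (1 / (1 + η) - (1 - η)) := by
      have : 1 / (1 + η) - (1 - η) = η ^ 2 / (1 + η) := by field_simp; ring
      rw [this]; positivity
    filter_upwards [(hlog.const_mul_atTop hpos).eventually_ge_atTop (u ^ 2)] with k hk
    have h2 := (Nat.lt_floor_add_one (2 * Real.log k / ((1 + η) * u ^ 2))).le
    have h3 : 2 * Real.log k / ((1 + η) * u ^ 2) * u ^ 2 = 2 * Real.log k * (1 / (1 + η)) := by
      field_simp
    have h4 := mul_le_mul_of_nonneg_right h2 (sq_nonneg u)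
    rw [h3] at h4
    change _ ≤ ((q k : ℝ) + 1) * u ^ 2 at h4
    linarith
  have hqpos : ∀ᶠ k : ℕ in atTop, 0 < q k := by
    filter_upwards [hqu, hlog.eventually_gt_atTop 0] with k h2 h3
    have h4 : 0 < (1 - η) * (2 * Real.log k) := mul_pos (by linarith) (by linarith)
    rcases Nat.eq_zero_or_pos (q k) with h | h
    · rw [h] at h2; simp at h2; linarith
    · exact h
  have hpq (k : ℕ) : p k * q k ≤ M k := Nat.div_mul_le_self _ _
  set c : ℕ → ℝ := fun k => q k * (u * √(p k))
  set A : ℕ → Set Ω := fun k =>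
    {ω | c k ≤ ∑ i ∈ Finset.Ico (ρ ^ k) (ρ ^ k + p k * q k), X i ω}
  have hb (k : ℕ) : ρ ^ k + p k * q k ≤ ρ ^ (k + 1) := by
    have h2 := hpq k
    have h3 := hMpow k
    simp only [M] at h2
    omega
  have hc : ∀ᶠ k : ℕ in atTop,
      (1 - η) * √(2 * ((ρ : ℝ) ^ (k + 1) - ρ ^ k) * Real.log k) ≤ c k := by
    filter_upwards [hqu, hqM (1 / η) (by positivity), hqpos] with k h2 h3 h4
    have hη' : 0 ≤ 1 - η := by linarith
    have hMlt : M k < p k * q k + q k := by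
      have := Nat.lt_div_mul_add (a := M k) h4
      exact this
    have hMlt' : (M k : ℝ) < p k * q k + q k := by exact_mod_cast hMlt
    -- Integer division loses fewer than q k indices, and q k ≤ η M k because q is logarithmic in k
    -- while M is exponential.
    have h5 : (1 - η) * M k ≤ p k * q k := by
      rw [one_div, inv_mul_le_iff₀ hη] at h3
      linarith
    have h6 : c k = √((q k * u ^ 2) * (p k * q k)) := by
      rw [show (q k * u ^ 2) * (p k * q k : ℝ) = (q k * u) ^ 2 * p k by ring,
        Real.sqrt_mul (by positivity), Real.sqrt_sq (by positivity)]
      simp only [c]; ring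
    rw [h6, ← hMcast]
    nth_rewrite 1 [← Real.sqrt_sq hη']
    rw [← Real.sqrt_mul (sq_nonneg _)]
    refine Real.sqrt_le_sqrt ?_
    calc (1 - η) ^ 2 * (2 * M k * Real.log k)
        = ((1 - η) * (2 * Real.log k)) * ((1 - η) * M k) := by ring
      _ ≤ _ := by
        have := hlog0 k
        gcongr
  have hA : ∀ᶠ k : ℕ in atTop, 1 / (k : ℝ) ≤ P.real (A k) := by
    filter_upwards [hqM p₀ (by positivity), hqpos, eventually_ge_atTop 1] with k h2 h3 h4
    have h4' : (0 : ℝ) < k := by exact_mod_cast h4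
    have hp : p₀ ≤ p k := by
      rw [Nat.le_div_iff_mul_le h3]; exact_mod_cast h2
    have h5 : P.real (A k) = P.real {ω | c k ≤ ∑ i ∈ Finset.range (p k * q k), X i ω} := by
      have := (identDistrib_sum_range_add hind hid (ρ ^ k) (p k * q k)).measure_mem_eq
        (s := Set.Ici (c k)) measurableSet_Ici
      simp only [A, Finset.sum_Ico_eq_sum_range, add_tsub_cancel_left]
      exact congrArg ENNReal.toReal this
    rw [h5]
    refine le_trans ?_ (pow_measureReal_le_measureReal_sum_mul hX hind hid (p k) (u * √(p k)) (q k))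
    refine le_trans ?_ (pow_le_pow_left₀ (Real.exp_pos _).le (hp₀ _ hp) _)
    rw [← Real.exp_nat_mul, one_div, ← Real.exp_log (inv_pos.2 h4'), Real.log_inv,
      Real.exp_le_exp]
    have h6 := hqle k
    rw [le_div_iff₀ (by positivity)] at h6
    linarith
  -- Second Borel-Cantelli lemma: the events are independent and their probabilities eventually
  -- dominate the harmonic series.
  have hBC : P (limsup A atTop) = 1 := by
    refine measure_limsup_eq_one (fun k => measurableSet_le measurable_const (by fun_prop))
      (iIndepSet_le_sum_Ico hX hind (a := fun k => ρ ^ k) (b := fun k => ρ ^ k + p k * q k)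
        (pow_right_mono₀ (by omega)) hb c) ?_
    by_contra hne
    have hs : Summable fun k => P.real (A k) := ENNReal.summable_toReal hne
    refine Real.not_summable_one_div_natCast ?_
    refine Summable.of_norm_bounded_eventually_nat hs ?_
    filter_upwards [hA] with k hk
    rwa [Real.norm_of_nonneg (by positivity)]
  have hmeas : MeasurableSet (limsup A atTop) :=
    MeasurableSet.measurableSet_limsup fun k => measurableSet_le measurable_const (by fun_prop)
  filter_upwards [(prob_compl_eq_zero_iff hmeas).2 hBC |> compl_mem_ae_iff.2] with ω hω
  rw [compl_compl, mem_limsup_iff_frequently_mem] at hω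
  refine (hω.and_eventually hc).mono fun k hk => ⟨ρ ^ k + p k * q k, by omega, hb k, ?_⟩
  exact hk.2.trans hk.1

theorem ae_frequently_le_sum {X : ℕ → Ω → ℝ} (hX : ∀ i, Measurable (X i))
    (hind : iIndepFun X P) (hid : ∀ i, IdentDistrib (X i) (X 0) P P)
    (hX2 : Integrable (fun ω => X 0 ω ^ 2) P) (h0 : ∫ ω, X 0 ω ∂P = 0)
    (h1 : ∫ ω, X 0 ω ^ 2 ∂P = 1) {ε : ℝ} (hε : 0 < ε) :
    ∀ᵐ ω ∂P, ∃ᶠ n : ℕ in atTop,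
      (1 - ε) * √(2 * n * Real.log (Real.log n)) ≤ ∑ i ∈ Finset.range n, X i ω := by
  -- Keeps 1 - ε nonnegative, so that an upper bound on the scale may be multiplied by it.
  wlog hε1 : ε ≤ 1 generalizing ε
  · filter_upwards [this one_pos le_rfl] with ω hω
    refine hω.mono fun n hn => le_trans ?_ hn
    gcongr
    linarith
  set δ := ε / 8
  have hδ : 0 < δ := by positivity
  have hδ1 : δ < 1 := by simp only [δ]; linarith
  -- A perfect square ρ makes √ρ = m + 2 explicit, so s = 1 / √ρ ≤ δ / 4.
  obtain ⟨m, hm⟩ := exists_nat_ge (4 / δ)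
  set ρ : ℕ := (m + 2) ^ 2
  have hρ2 : 2 ≤ ρ := 
    le_trans (by omega) (Nat.le_self_pow two_ne_zero (m + 2))
  have hρ1 : (1 : ℝ) < ρ := by exact_mod_cast hρ2
  have hsρ : √(ρ : ℝ) = m + 2 := by
    simp only [ρ]; push_cast; exact Real.sqrt_sq (by positivity)
  set s := (√(ρ : ℝ))⁻¹
  have hs0 : 0 ≤ s := by positivity
  have hsδ : s ≤ δ / 4 := by
    simp only [s]; rw [hsρ, inv_le_comm₀ (by positivity) (by positivity), inv_div]
    linarith
  have hs2 : s ^ 2 = (ρ : ℝ)⁻¹ := by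
    simp only [s]; rw [inv_pow, Real.sq_sqrt (by positivity)]
  have hX' : ∀ i, Measurable (fun ω => -X i ω) := fun i => (hX i).neg
  -- The crude constant 2 (η = 1) suffices for the prefix up to ρ^k, since its scale is only about s
  -- times that of the block end.
  have hup := ae_eventually_sum_le (X := fun i ω => -X i ω) hX'
    (hind.comp (fun _ x => -x) fun _ => measurable_neg)
    (fun i => (hid i).comp measurable_neg) (by simpa using hX2)
    (by rw [integral_neg, h0, neg_zero]) (by simpa using h1) one_pos
  filter_upwards [hup, ae_frequently_le_sum_Ico_pow hX hind hid h0 h1 hδ hδ1 hρ2] with ω hω1 hω2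
  have hpow : Tendsto (fun k : ℕ => ρ ^ k) atTop atTop :=
    tendsto_pow_atTop_atTop_of_one_lt (by omega)
  have hlog : Tendsto (fun k : ℕ => Real.log k) atTop atTop :=
    Real.tendsto_log_atTop.comp tendsto_natCast_atTop_atTop
  have hll : ∀ᶠ k : ℕ in atTop,
      Real.log (k + 1 : ℕ) + Real.log (Real.log ρ) ≤ (1 + δ) * Real.log k := by
    have hδ2 : 0 < δ / 2 := by positivity
    filter_upwards [eventually_log_succ_le hδ2 0, (hlog.const_mul_atTop hδ2).eventually_ge_atTop
      (Real.log (Real.log ρ))] with k h2 h3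
    push_cast
    linarith
  rw [frequently_atTop]
  intro N
  obtain ⟨k, ⟨n, hn1, hn2, hn3⟩, hk1, hk2, hk3, hk4⟩ :=
    (hω2.and_eventually ((hpow.eventually hω1).and (hll.and
      ((hpow.eventually_ge_atTop N).and (eventually_ge_atTop 2))))).exists
  refine ⟨n, hk3.trans hn1, ?_⟩
  have hk4' : (2 : ℝ) ≤ k := by exact_mod_cast hk4
  set L := Real.log k
  have hL : 0 < L := Real.log_pos (by linarith)
  have hn1' : (ρ : ℝ) ^ k ≤ n := by exact_mod_cast hn1
  have hn2' : (n : ℝ) ≤ (ρ : ℝ) ^ (k + 1) := by exact_mod_cast hn2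
  set B := √(2 * (ρ : ℝ) ^ (k + 1) * L)
  have hB0 : 0 ≤ B := Real.sqrt_nonneg _
  have hscale : √(2 * n * Real.log (Real.log n)) ≤ (1 + δ) * B := by
    refine (sqrt_mul_le_of_le (by positivity) hδ.le hL.le
      (log_log_le_of_pow_le hρ1 (by omega) hk2 hn1' hn2')).trans ?_
    refine mul_le_mul_of_nonneg_left (Real.sqrt_le_sqrt ?_) (by positivity)
    gcongr
  have hsB : s * B = √(2 * (ρ : ℝ) ^ k * L) := by
    rw [← Real.sqrt_sq hs0, ← Real.sqrt_mul (sq_nonneg _), hs2, pow_succ]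
    congr 1
    field_simp
  have hscale' : √(2 * (ρ : ℝ) ^ k * Real.log (Real.log ((ρ : ℝ) ^ k))) ≤ (1 + δ) * (s * B) := by
    rw [hsB]
    exact sqrt_mul_le_of_le (by positivity) hδ.le hL.le
      (log_log_le_of_pow_le hρ1 (by omega) hk2 le_rfl (hn1'.trans hn2'))
  have hblock : (1 - s) * B ≤ √(2 * ((ρ : ℝ) ^ (k + 1) - ρ ^ k) * L) := by
    have hs1 : 0 ≤ 1 - s := by linarith
    rw [← Real.sqrt_sq hs1, ← Real.sqrt_mul (sq_nonneg _)]
    refine Real.sqrt_le_sqrt ?_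
    have h2 : ((ρ : ℝ) ^ (k + 1) - ρ ^ k) = (1 - s ^ 2) * (ρ : ℝ) ^ (k + 1) := by
      rw [hs2, pow_succ]; field_simp
    rw [h2]
    have h3 : (1 - s) ^ 2 ≤ 1 - s ^ 2 := by nlinarith
    calc _ ≤ (1 - s ^ 2) * (2 * (ρ : ℝ) ^ (k + 1) * L) := by gcongr
      _ = _ := by ring
  have hprev : -((1 + 1) * ((1 + δ) * (s * B))) ≤ ∑ i ∈ Finset.range (ρ ^ k), X i ω := by
    have h2 : ∑ i ∈ Finset.range (ρ ^ k), -X i ω ≤ (1 + 1) * ((1 + δ) * (s * B)) := by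
      refine hk1.trans ?_
      push_cast
      gcongr
    rw [Finset.sum_neg_distrib] at h2
    linarith
  have hmain : (1 - ε) * ((1 + δ) * B) ≤
      (1 - δ) * ((1 - s) * B) - (1 + 1) * ((1 + δ) * (s * B)) := by
    have h2 : ε = 8 * δ := by simp only [δ]; ring
    have h3 : 0 ≤ (1 - δ) * s := mul_nonneg (by linarith) hs0
    have h4 : 0 ≤ ((1 - δ) * (1 - s) - (1 + 1) * ((1 + δ) * s) - (1 - ε) * (1 + δ)) * B := by
      refine mul_nonneg ?_ hB0
      rw [h2]
      linarith [sq_nonneg δ]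
    linarith
  rw [← Finset.sum_range_add_sum_Ico _ hn1]
  calc _ ≤ (1 - ε) * ((1 + δ) * B) := by gcongr
    _ ≤ _ := hmain
    _ ≤ _ := by
      have : (1 - δ) * ((1 - s) * B) ≤ (1 - δ) * √(2 * ((ρ : ℝ) ^ (k + 1) - ρ ^ k) * L) := by
        gcongr
      linarith

end

/-! ### Real limits superior and the Hartman-Wintner law -/

/-- The real number `L` is the limit superior of the real sequence `u`. -/
def IsRealLimsup (u : ℕ → ℝ) (L : ℝ) : Prop :=
  (∀ ε > 0, ∀ᶠ n in atTop, u n ≤ L + ε) ∧ ∀ ε > 0, ∃ᶠ n in atTop, L - ε ≤ u n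

theorem IsRealLimsup.limsup_eq {u : ℕ → ℝ} {L : ℝ} (h : IsRealLimsup u L) :
    limsup (fun n => (u n : EReal)) atTop = (L : EReal) := by
  refine le_antisymm (EReal.le_of_forall_lt_iff_le.1 fun z hz => ?_)
    (EReal.ge_of_forall_gt_iff_ge.1 fun z hz => ?_)
  · have hz' := EReal.coe_lt_coe_iff.1 hz
    refine limsup_le_of_le (h := ?_)
    filter_upwards [h.1 (z - L) (by linarith)] with n hn
    exact EReal.coe_le_coe_iff.2 (by linarith)
  · have hz' := EReal.coe_lt_coe_iff.1 hz
    refine le_limsup_of_frequently_le' ((h.2 (L - z) (by linarith)).mono fun n hn => ?_)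
    exact EReal.coe_le_coe_iff.2 (by linarith)

theorem IsRealLimsup.liminf_eq {u : ℕ → ℝ} {L : ℝ} (h : IsRealLimsup (fun n => -u n) L) :
    liminf (fun n => (u n : EReal)) atTop = ((-L : ℝ) : EReal) := by
  have h1 := h.limsup_eq
  have h2 : (fun n => ((-u n : ℝ) : EReal)) = -fun n => (u n : EReal) := by ext; simp
  rw [h2, EReal.limsup_neg] at h1
  rw [EReal.coe_neg, ← h1, neg_neg]

theorem IsRealLimsup.mul_tendsto {u v c : ℕ → ℝ} {L a : ℝ} (h : IsRealLimsup u L)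
    (hc : Tendsto c atTop (𝓝 a)) (ha : 0 < a) (hv : ∀ᶠ n in atTop, v n = u n * c n) :
    IsRealLimsup v (L * a) := by
  refine ⟨fun ε hε => ?_, fun ε hε => ?_⟩
  · have hlim : Tendsto (fun n => (L + ε / (2 * a)) * c n) atTop (𝓝 (L * a + ε / 2)) := by
      convert hc.const_mul (L + ε / (2 * a)) using 2
      field_simp
    filter_upwards [h.1 (ε / (2 * a)) (by positivity), hv,
      hlim.eventually_le_const (show L * a + ε / 2 < L * a + ε by linarith),
      hc.eventually_const_lt ha] with n h1 h2 h3 h4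
    rw [h2]
    exact (mul_le_mul_of_nonneg_right h1 h4.le).trans h3
  · have hlim : Tendsto (fun n => (L - ε / (2 * a)) * c n) atTop (𝓝 (L * a - ε / 2)) := by
      convert hc.const_mul (L - ε / (2 * a)) using 2
      field_simp
    refine ((h.2 (ε / (2 * a)) (by positivity)).and_eventually (hv.and
      ((hlim.eventually_const_le (show L * a - ε < L * a - ε / 2 by linarith)).and
        (hc.eventually_const_lt ha)))).mono fun n ⟨h1, h2, h3, h4⟩ => ?_
    rw [h2]
    exact h3.trans (mul_le_mul_of_nonneg_right h1 h4.le)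

theorem eventually_mul_lilScale :
    ∀ᶠ n : ℕ in atTop, 0 < lilScale n ∧ n * lilScale n = √(2 * n * Real.log (Real.log n)) := by
  have h := (Real.tendsto_log_atTop.comp Real.tendsto_log_atTop).comp
    (tendsto_natCast_atTop_atTop (R := ℝ))
  filter_upwards [h.eventually_gt_atTop 0, eventually_ge_atTop 1] with n hn hn1
  have hn1' : (0 : ℝ) < n := by exact_mod_cast hn1
  simp only [Function.comp_apply] at hn
  refine ⟨Real.sqrt_pos.2 (by positivity), ?_⟩
  rw [lilScale]
  nth_rewrite 1 [← Real.sqrt_sq hn1'.le]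
  rw [← Real.sqrt_mul (sq_nonneg _)]
  congr 1
  field_simp

section

variable {Ω : Type*} [MeasurableSpace Ω] {P : Measure Ω} [IsProbabilityMeasure P]

/-- The **Hartman-Wintner law of the iterated logarithm**. -/
theorem ae_isRealLimsup_sum_div_lilScale {X : ℕ → Ω → ℝ} (hX : ∀ i, Measurable (X i))
    (hind : iIndepFun X P) (hid : ∀ i, IdentDistrib (X i) (X 0) P P)
    (hX2 : Integrable (fun ω => X 0 ω ^ 2) P) (h0 : ∫ ω, X 0 ω ∂P = 0)
    (hpos : 0 < ∫ ω, X 0 ω ^ 2 ∂P) :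
    ∀ᵐ ω ∂P, IsRealLimsup (fun n => (∑ i ∈ Finset.range n, X i ω) / n / lilScale n)
      √(∫ ω, X 0 ω ^ 2 ∂P) := by
  set v := ∫ ω, X 0 ω ^ 2 ∂P
  have hs : 0 < √v := Real.sqrt_pos.2 hpos
  set Y : ℕ → Ω → ℝ := fun i ω => X i ω / √v
  have hY (i : ℕ) : Measurable (Y i) := (hX i).div_const _
  have hYind : iIndepFun Y P := hind.comp (fun _ x => x / √v) fun _ => measurable_id.div_const _
  have hYid (i : ℕ) : IdentDistrib (Y i) (Y 0) P P :=
    (hid i).comp (measurable_id.div_const (√v))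
  have hY2 : Integrable (fun ω => Y 0 ω ^ 2) P := by
    simp only [Y, div_pow]; exact hX2.div_const _
  have hY0 : ∫ ω, Y 0 ω ∂P = 0 := by simp only [Y]; rw [integral_div, h0, zero_div]
  have hY1 : ∫ ω, Y 0 ω ^ 2 ∂P = 1 := by
    simp only [Y, div_pow]
    rw [integral_div, Real.sq_sqrt hpos.le, div_self hpos.ne']
  -- Restricting to the countably many tolerances 1 / (m + 1) gives a single null set valid for
  -- every ε.
  have hup : ∀ᵐ ω ∂P, ∀ m : ℕ, ∀ᶠ n : ℕ in atTop, ∑ i ∈ Finset.range n, Y i ω ≤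
      (1 + 1 / ((m : ℝ) + 1)) * √(2 * n * Real.log (Real.log n)) :=
    ae_all_iff.2 fun m => ae_eventually_sum_le hY hYind hYid hY2 hY0 hY1 (by positivity)
  have hlow : ∀ᵐ ω ∂P, ∀ m : ℕ, ∃ᶠ n : ℕ in atTop,
      (1 - 1 / ((m : ℝ) + 1)) * √(2 * n * Real.log (Real.log n)) ≤
        ∑ i ∈ Finset.range n, Y i ω :=
    ae_all_iff.2 fun m => ae_frequently_le_sum hY hYind hYid hY2 hY0 hY1 (by positivity)
  filter_upwards [hup, hlow] with ω h1 h2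
  have hYX (n : ℕ) : ∑ i ∈ Finset.range n, X i ω = √v * ∑ i ∈ Finset.range n, Y i ω := by
    rw [Finset.mul_sum]
    exact Finset.sum_congr rfl fun i _ => by simp only [Y]; field_simp
  have hev := eventually_mul_lilScale.and (eventually_ge_atTop 1)
  refine ⟨fun ε hε => ?_, fun ε hε => ?_⟩ <;>
    obtain ⟨m, hm⟩ := exists_nat_one_div_lt (show 0 < ε / √v by positivity) <;>
    rw [lt_div_iff₀ hs] at hm
  · filter_upwards [h1 m, hev] with n h3 ⟨⟨h4, h5⟩, h6⟩
    have h6' : (0 : ℝ) < n := by exact_mod_cast h6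
    rw [div_div, div_le_iff₀ (by positivity), hYX]
    rw [← h5] at h3
    calc _ ≤ √v * ((1 + 1 / ((m : ℝ) + 1)) * (n * lilScale n)) := by gcongr
      _ = (√v + 1 / ((m : ℝ) + 1) * √v) * (n * lilScale n) := by ring
      _ ≤ _ := by gcongr
  · refine ((h2 m).and_eventually hev).mono fun n ⟨h3, ⟨h4, h5⟩, h6⟩ => ?_
    have h6' : (0 : ℝ) < n := by exact_mod_cast h6
    beta_reduce
    rw [div_div, le_div_iff₀ (by positivity), hYX]
    rw [← h5] at h3
    calc (√v - ε) * (n * lilScale n)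
        ≤ (√v - 1 / ((m : ℝ) + 1) * √v) * (n * lilScale n) := by gcongr
      _ = √v * ((1 - 1 / ((m : ℝ) + 1)) * (n * lilScale n)) := by ring
      _ ≤ _ := by gcongr

/-! ### The Bajraktarević expectation and its asymptotic variance -/

/-- With m the quotient, p(ξ)(f(ξ) - m) has integral zero, so it cannot be a.s. of one strict sign.
Hence f takes values on both sides of m (weakly), and m lies in the interval f(I). -/
theorem bajExpectation_spec {I : Set ℝ} (hI : I.OrdConnected) {f p : ℝ → ℝ}
    (hf : ContinuousOn f I) (hp : ∀ x ∈ I, 0 < p x) {ξ : Ω → ℝ} (hξ : ∀ᵐ ω ∂P, ξ ω ∈ I)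
    (hpint : Integrable (fun ω => p (ξ ω)) P)
    (hpf : Integrable (fun ω => p (ξ ω) * f (ξ ω)) P) :
    0 < ∫ ω, p (ξ ω) ∂P ∧
      f (bajExpectation P I f p ξ) = (∫ ω, p (ξ ω) * f (ξ ω) ∂P) / ∫ ω, p (ξ ω) ∂P := by
  have hne {g : Ω → ℝ} (hg : ∀ᵐ ω ∂P, 0 < g ω) (hgi : Integrable g P) : 0 < ∫ ω, g ω ∂P := by
    refine lt_of_le_of_ne (integral_nonneg_of_ae (hg.mono fun _ h => h.le)) fun h => ?_
    have h2 := (integral_eq_zero_iff_of_nonneg_ae (hg.mono fun _ h => h.le) hgi).1 h.symm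
    obtain ⟨ω, h3, h4⟩ := (hg.and h2).exists
    exact h3.ne' h4
  have ha : 0 < ∫ ω, p (ξ ω) ∂P := hne (hξ.mono fun ω h => hp _ h) hpint
  refine ⟨ha, ?_⟩
  set m := (∫ ω, p (ξ ω) * f (ξ ω) ∂P) / ∫ ω, p (ξ ω) ∂P with hm
  have hint : Integrable (fun ω => p (ξ ω) * f (ξ ω) - m * p (ξ ω)) P := hpf.sub (hpint.const_mul _)
  have hzero : ∫ ω, (p (ξ ω) * f (ξ ω) - m * p (ξ ω)) ∂P = 0 := by
    rw [integral_sub hpf (hpint.const_mul _), integral_const_mul, hm]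
    field_simp
    ring
  have hx : ∃ x ∈ I, f x ≤ m := by
    by_contra! hcon
    refine (hne (hξ.mono fun ω h => ?_) hint).ne' hzero
    have := mul_lt_mul_of_pos_left (hcon _ h) (hp _ h)
    linarith
  have hy : ∃ y ∈ I, m ≤ f y := by
    by_contra! hcon
    refine (hne (g := fun ω => -(p (ξ ω) * f (ξ ω) - m * p (ξ ω))) (hξ.mono fun ω h => ?_)
      hint.neg).ne' (by rw [integral_neg, hzero, neg_zero])
    have := mul_lt_mul_of_pos_left (hcon _ h) (hp _ h)
    linarith
  obtain ⟨x, hxI, hx⟩ := hx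
  obtain ⟨y, hyI, hy⟩ := hy
  have hmem : m ∈ f '' I :=
    (hI.isPreconnected.image f hf).ordConnected.out ⟨x, hxI, rfl⟩ ⟨y, hyI, rfl⟩ ⟨hx, hy⟩
  exact Function.invFunOn_eq hmem

/-- With a = E p and b = E pf, the bracket is Var(a·pf - b·p) = a² Var(p(f - b/a)), and p(f - b/a)
is centred. -/
theorem bajSigmaSq_eq {I : Set ℝ} {f p : ℝ → ℝ} {ξ : Ω → ℝ}
    (hp : MemLp (fun ω => p (ξ ω)) 2 P) (hpf : MemLp (fun ω => p (ξ ω) * f (ξ ω)) 2 P)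
    (ha : 0 < ∫ ω, p (ξ ω) ∂P) :
    bajSigmaSq P I f p ξ = (∫ ω, (p (ξ ω) * (f (ξ ω) -
        (∫ ω, p (ξ ω) * f (ξ ω) ∂P) / ∫ ω, p (ξ ω) ∂P)) ^ 2 ∂P) /
      ((∫ ω, p (ξ ω) ∂P) * deriv f (bajExpectation P I f p ξ)) ^ 2 := by
  rw [bajSigmaSq, variance_eq_sub hp, variance_eq_sub hpf, covariance_eq_sub hp hpf]
  simp only [Pi.pow_apply, Pi.mul_apply]
  set a := ∫ ω, p (ξ ω) ∂P
  set b := ∫ ω, p (ξ ω) * f (ξ ω) ∂P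
  have hsq : ∫ ω, (p (ξ ω) * (f (ξ ω) - b / a)) ^ 2 ∂P =
      ∫ ω, (p (ξ ω) * f (ξ ω)) ^ 2 ∂P - 2 * (b / a) * ∫ ω, p (ξ ω) * (p (ξ ω) * f (ξ ω)) ∂P +
        (b / a) ^ 2 * ∫ ω, p (ξ ω) ^ 2 ∂P := by
    have h1 : Integrable (fun ω => (p (ξ ω) * f (ξ ω)) ^ 2) P := hpf.integrable_sq
    have h2 : Integrable (fun ω => p (ξ ω) ^ 2) P := hp.integrable_sq
    have h3 : Integrable (fun ω => p (ξ ω) * (p (ξ ω) * f (ξ ω))) P := hp.integrable_mul hpf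
    have h4 : Integrable (fun ω => (p (ξ ω) * f (ξ ω)) ^ 2 -
        2 * (b / a) * (p (ξ ω) * (p (ξ ω) * f (ξ ω)))) P := h1.sub (h3.const_mul _)
    rw [← integral_const_mul, ← integral_const_mul, ← integral_sub h1 (h3.const_mul _),
      ← integral_add h4 (h2.const_mul _)]
    congr with ω
    ring
  rw [hsq]
  field_simp
  ring

end

/-! ### The delta method for strictly increasing functions -/

theorem deriv_pos_of_strictMonoOn {I : Set ℝ} {f : ℝ → ℝ} (hf : StrictMonoOn f I) {t : ℝ}
    (ht : t ∈ interior I) (hd : DifferentiableAt ℝ f t) (hne : deriv f t ≠ 0) :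
    0 < deriv f t := by
  refine lt_of_le_of_ne ?_ hne.symm
  refine ge_of_tendsto (hasDerivAt_iff_tendsto_slope.1 hd.hasDerivAt) ?_
  filter_upwards [nhdsWithin_le_nhds (mem_interior_iff_mem_nhds.1 ht)] with x hx
  rw [slope_comm]
  exact hf.monotoneOn.slope_nonneg hx (interior_subset ht)

/-- Strict monotonicity alone makes the inverse continuous at f t: once f(t - δ) < f(B n) < f(t +
δ), B n is within δ of t. -/
theorem tendsto_of_tendsto_strictMonoOn {I : Set ℝ} {f : ℝ → ℝ} (hf : StrictMonoOn f I) {t : ℝ}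
    (ht : t ∈ interior I) {B : ℕ → ℝ} (hB : ∀ᶠ n in atTop, B n ∈ I)
    (h : Tendsto (fun n => f (B n)) atTop (𝓝 (f t))) : Tendsto B atTop (𝓝 t) := by
  obtain ⟨r, hr, hrI⟩ := Metric.mem_nhds_iff.1 (mem_interior_iff_mem_nhds.1 ht)
  rw [Metric.tendsto_atTop']
  intro ε hε
  set δ := min (r / 2) (ε / 2)
  have hδ : 0 < δ := by positivity
  have hδr : δ < r := (min_le_left _ _).trans_lt (by linarith)
  have hδε : δ < ε := (min_le_right _ _).trans_lt (by linarith)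
  have htI : t ∈ I := interior_subset ht
  have h1 : t - δ ∈ I := hrI (by simp [abs_of_pos hδ, hδr])
  have h2 : t + δ ∈ I := hrI (by simp [abs_of_pos hδ, hδr])
  obtain ⟨N, hN⟩ := ((h.eventually_const_lt (hf h1 htI (by linarith))).and
    ((h.eventually_lt_const (hf htI h2 (by linarith))).and hB)).exists_forall_of_atTop
  refine ⟨N, fun n hn => ?_⟩
  obtain ⟨h3, h4, h5⟩ := hN n hn.le
  have h6 := (hf.lt_iff_lt h1 h5).1 h3
  have h7 := (hf.lt_iff_lt h5 h2).1 h4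
  rw [Real.dist_eq, abs_lt]
  constructor <;> linarith

/-- The delta method: a limit superior of normalized errors is carried over by the inverse of a
function that is strictly increasing on `I` and differentiable at the limit point. -/
theorem IsRealLimsup.of_eq_mul {I : Set ℝ} {f : ℝ → ℝ} (hf : StrictMonoOn f I) {t : ℝ}
    (ht : t ∈ interior I) (hd : DifferentiableAt ℝ f t) (hne : deriv f t ≠ 0) {B u w c : ℕ → ℝ}
    (hB : ∀ᶠ n in atTop, B n ∈ I) (hu0 : Tendsto u atTop (𝓝 0)) {a L : ℝ} (ha : 0 < a)
    (hw : Tendsto w atTop (𝓝 a)) (hfB : ∀ᶠ n in atTop, f (B n) = f t + u n / w n)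
    {s : ℝ} (hL : IsRealLimsup (fun n => s * (u n / c n)) L) :
    IsRealLimsup (fun n => s * ((B n - t) / c n)) (L * (a * deriv f t)⁻¹) := by
  have hpos := deriv_pos_of_strictMonoOn hf ht hd hne
  have hfB' : Tendsto (fun n => f (B n)) atTop (𝓝 (f t)) := by
    have h := (hu0.div hw ha.ne').const_add (f t)
    rw [zero_div, add_zero] at h
    exact h.congr' (hfB.mono fun n h => h.symm)
  have hBt := tendsto_of_tendsto_strictMonoOn hf ht hB hfB'
  -- `dslope` takes the value f'(t) at t, so indices with B n = t need no separate treatment.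
  have hslope : Tendsto (fun n => dslope f t (B n)) atTop (𝓝 (deriv f t)) := by
    have := (continuousAt_dslope_same.2 hd).tendsto.comp hBt
    rwa [dslope_same] at this
  have hc := (hw.mul hslope).inv₀ (by positivity)
  refine hL.mul_tendsto hc (by positivity) ?_
  filter_upwards [hfB, hw.eventually_const_lt ha, hslope.eventually_const_lt hpos]
    with n h1 h2 h3
  have h4 := sub_smul_dslope f t (B n)
  rw [h1, add_sub_cancel_left, smul_eq_mul] at h4
  have h5 : B n - t = u n * (w n * dslope f t (B n))⁻¹ := by
    rw [eq_div_iff h2.ne'] at h4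
    rw [← div_eq_mul_inv, eq_div_iff (by positivity)]
    linarith
  rw [h5]
  ring

/-! ### Application to Bajraktarević and quasi-arithmetic means -/

theorem measurable_indicator_of_measurable_subtype {I : Set ℝ} (hI : MeasurableSet I) {g : ℝ → ℝ}
    (hg : Measurable fun x : I => g x) : Measurable (I.indicator g) := by
  have h1 : I.domRestrict (I.indicator g) = fun x : I => g x :=
    funext fun x => Set.indicator_of_mem x.2 _
  have h2 : Iᶜ.domRestrict (I.indicator g) = 0 :=
    funext fun x => Set.indicator_of_notMem x.2 _
  exact measurable_of_restrict_of_restrict_compl hI (h1 ▸ hg) (h2 ▸ measurable_zero)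

section

variable {Ω : Type*} [MeasurableSpace Ω] {P : Measure Ω} [IsProbabilityMeasure P]

/-- The sign s covers both halves at once: s = -1 is the law applied to the negated summands and
yields the limit inferior. -/
theorem bajMean_isRealLimsup {I : Set ℝ} (hI : I.OrdConnected)
    {f : ℝ → ℝ} (hf_cont : ContinuousOn f I) (hf_mono : StrictMonoOn f I)
    {ξ : ℕ → Ω → ℝ} (hξ_meas : ∀ n, Measurable (ξ n)) (hξ_indep : iIndepFun ξ P)
    (hξ_ident : ∀ n, IdentDistrib (ξ n) (ξ 0) P P)
    (hξ_mem : ∀ᵐ ω ∂P, ξ 0 ω ∈ I)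
    (hξ_nonconst : ¬ ∃ c : ℝ, ∀ᵐ ω ∂P, ξ 0 ω = c)
    {p : ℝ → ℝ} (hp_meas : Measurable (fun x : I => p x)) (hp : ∀ x ∈ I, 0 < p x)
    (hp2 : Integrable (fun ω => p (ξ 0 ω) ^ 2) P)
    (hpf2 : Integrable (fun ω => p (ξ 0 ω) ^ 2 * f (ξ 0 ω) ^ 2) P)
    (ht : bajExpectation P I f p (ξ 0) ∈ interior I)
    (hd : DifferentiableAt ℝ f (bajExpectation P I f p (ξ 0)))
    (hne : deriv f (bajExpectation P I f p (ξ 0)) ≠ 0) :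
    f (bajExpectation P I f p (ξ 0)) =
        (∫ ω, p (ξ 0 ω) * f (ξ 0 ω) ∂P) / ∫ ω, p (ξ 0 ω) ∂P ∧
      0 < bajSigmaSq P I f p (ξ 0) ∧
      ∀ᵐ ω ∂P, ∀ s : ℝ, s = 1 ∨ s = -1 → IsRealLimsup (fun n : ℕ => s *
        ((bajMean I f p (fun i : Fin n => ξ i ω) - bajExpectation P I f p (ξ 0)) / lilScale n))
        √(bajSigmaSq P I f p (ξ 0)) := by
  have hIm : MeasurableSet I := hI.measurableSet
  -- Off I nothing is known about p and f; their extensions by zero are measurable on ℝ and agree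
  -- with them almost surely along the sample.
  set p' := I.indicator p
  set f' := I.indicator f
  have hp' : Measurable p' := measurable_indicator_of_measurable_subtype hIm hp_meas
  have hf' : Measurable f' :=
    measurable_indicator_of_measurable_subtype hIm hf_cont.domRestrict.measurable
  have hpp (x : ℝ) (hx : x ∈ I) : p' x = p x := Set.indicator_of_mem hx _
  have hff (x : ℝ) (hx : x ∈ I) : f' x = f x := Set.indicator_of_mem hx _
  have hpL : MemLp (fun ω => p (ξ 0 ω)) 2 P := by
    refine (memLp_two_iff_integrable_sq ?_).2 hp2
    exact (hp'.comp (hξ_meas 0)).aestronglyMeasurable.congr (hξ_mem.mono fun ω h => hpp _ h)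
  have hpfL : MemLp (fun ω => p (ξ 0 ω) * f (ξ 0 ω)) 2 P := by
    refine (memLp_two_iff_integrable_sq ?_).2 (by simpa only [mul_pow] using hpf2)
    refine ((hp'.mul hf').comp (hξ_meas 0)).aestronglyMeasurable.congr
      (hξ_mem.mono fun ω h => ?_)
    simp [hpp _ h, hff _ h]
  have hpint : Integrable (fun ω => p (ξ 0 ω)) P := hpL.integrable (by norm_num)
  have hpfint : Integrable (fun ω => p (ξ 0 ω) * f (ξ 0 ω)) P := hpfL.integrable (by norm_num)
  obtain ⟨ha, hspec⟩ := bajExpectation_spec hI hf_cont hp hξ_mem hpint hpfint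
  have hsig := bajSigmaSq_eq (I := I) hpL hpfL ha
  refine ⟨hspec, ?_⟩
  set t := bajExpectation P I f p (ξ 0)
  have htI : t ∈ I := interior_subset ht
  rw [← hspec] at hsig
  set a := ∫ ω, p (ξ 0 ω) ∂P
  have hderiv : 0 < deriv f t := deriv_pos_of_strictMonoOn hf_mono ht hd hne
  -- Centring at f t makes f(B_n) - f t exactly the quotient of Σ g(ξ i) by Σ p(ξ i).
  set g : ℝ → ℝ := fun x => p' x * (f' x - f t)
  have hg : Measurable g := hp'.mul (hf'.sub_const _)
  have hgx (x : ℝ) (hx : x ∈ I) : g x = p x * (f x - f t) := by simp only [g, hpp x hx, hff x hx]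
  set X : ℕ → Ω → ℝ := fun i ω => g (ξ i ω)
  have hX (i : ℕ) : Measurable (X i) := hg.comp (hξ_meas i)
  have hXind : iIndepFun X P := hξ_indep.comp (fun _ => g) fun _ => hg
  have hXid (i : ℕ) : IdentDistrib (X i) (X 0) P P := (hξ_ident i).comp hg
  have hX0ae : ∀ᵐ ω ∂P, X 0 ω = p (ξ 0 ω) * f (ξ 0 ω) - f t * p (ξ 0 ω) :=
    hξ_mem.mono fun ω h => by simp only [X]; rw [hgx _ h]; ring
  have hX0L : MemLp (X 0) 2 P :=
    (memLp_congr_ae hX0ae).2 (hpfL.sub (hpL.const_mul _))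
  have hX2 : Integrable (fun ω => X 0 ω ^ 2) P := hX0L.integrable_sq
  have hX0int : Integrable (X 0) P := hX0L.integrable (by norm_num)
  have h0 : ∫ ω, X 0 ω ∂P = 0 := by
    rw [integral_congr_ae hX0ae, integral_sub hpfint (hpint.const_mul _), integral_const_mul,
      hspec]
    field_simp
    ring
  have hv : ∫ ω, X 0 ω ^ 2 ∂P = ∫ ω, (p (ξ 0 ω) * (f (ξ 0 ω) - f t)) ^ 2 ∂P :=
    integral_congr_ae (hξ_mem.mono fun ω h => by simp only [X]; rw [hgx _ h])
  -- A vanishing second moment would force f(ξ) = f t a.s., as p > 0, and hence ξ = t a.s. by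
  -- injectivity.
  have hvpos : 0 < ∫ ω, X 0 ω ^ 2 ∂P := by
    refine lt_of_le_of_ne (integral_nonneg fun ω => sq_nonneg _) fun h => hξ_nonconst ⟨t, ?_⟩
    have h2 := (integral_eq_zero_iff_of_nonneg (fun ω => sq_nonneg (X 0 ω)) hX2).1 h.symm
    filter_upwards [h2, hξ_mem] with ω h3 h4
    have h5 : X 0 ω = 0 := by simpa using h3
    simp only [X] at h5
    rw [hgx _ h4] at h5
    have h6 := (mul_eq_zero.1 h5).resolve_left (hp _ h4).ne'
    exact hf_mono.injOn h4 htI (by linarith)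
  rw [← hv] at hsig
  have hsqrt : √(bajSigmaSq P I f p (ξ 0)) = √(∫ ω, X 0 ω ^ 2 ∂P) * (a * deriv f t)⁻¹ := by
    rw [hsig, Real.sqrt_div hvpos.le, Real.sqrt_sq (by positivity), div_eq_mul_inv]
  refine ⟨by rw [hsig]; positivity, ?_⟩
  have hlil1 := ae_isRealLimsup_sum_div_lilScale hX hXind hXid hX2 h0 hvpos
  have hlil2 := ae_isRealLimsup_sum_div_lilScale (X := fun i ω => -X i ω) (fun i => (hX i).neg)
    (hXind.comp (fun _ x => -x) fun _ => measurable_neg) (fun i => (hXid i).comp measurable_neg)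
    (by simpa using hX2) (by rw [integral_neg, h0, neg_zero]) (by simpa using hvpos)
  have hslln := strong_law_ae_real X hX0int (fun i j hij => hXind.indepFun hij) hXid
  rw [h0] at hslln
  set W : ℕ → Ω → ℝ := fun i ω => p' (ξ i ω)
  have hWae : W 0 =ᵐ[P] fun ω => p (ξ 0 ω) := hξ_mem.mono fun ω h => hpp _ h
  have hsllnW := strong_law_ae_real W (hpint.congr hWae.symm)
    (fun i j hij => (hξ_indep.comp (fun _ => p') fun _ => hp').indepFun hij)
    (fun i => (hξ_ident i).comp hp')
  rw [integral_congr_ae hWae] at hsllnW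
  have hmem : ∀ᵐ ω ∂P, ∀ i, ξ i ω ∈ I :=
    ae_all_iff.2 fun i => (hξ_ident i).symm.ae_mem_snd hIm hξ_mem
  filter_upwards [hlil1, hlil2, hslln, hsllnW, hmem] with ω hω1 hω2 hω3 hω4 hω5
  have hspecB (n : ℕ) (hn : 0 < n) := bajMean_spec hI hf_cont hp hn (fun i : Fin n => ξ i ω)
    fun i => hω5 i
  have hfB : ∀ᶠ n : ℕ in atTop, f (bajMean I f p fun i : Fin n => ξ i ω) =
      f t + (∑ i ∈ Finset.range n, X i ω) / n / ((∑ i ∈ Finset.range n, W i ω) / n) := by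
    filter_upwards [eventually_gt_atTop 0, hω4.eventually_const_lt ha] with n hn hW
    have hn' : (0 : ℝ) < n := by exact_mod_cast hn
    have hWpos : 0 < ∑ i ∈ Finset.range n, W i ω := by
      by_contra hcon
      exact absurd hW (not_lt.2 (div_nonpos_of_nonpos_of_nonneg (not_lt.1 hcon) hn'.le))
    rw [(hspecB n hn).2, div_div_div_cancel_right₀ hn'.ne',
      ← Finset.sum_range fun i => p (ξ i ω) * f (ξ i ω), ← Finset.sum_range fun i => p (ξ i ω)]
    have e1 : ∑ i ∈ Finset.range n, p (ξ i ω) = ∑ i ∈ Finset.range n, W i ω :=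
      Finset.sum_congr rfl fun i _ => (hpp _ (hω5 i)).symm
    have e2 : ∑ i ∈ Finset.range n, p (ξ i ω) * f (ξ i ω) =
        ∑ i ∈ Finset.range n, X i ω + f t * ∑ i ∈ Finset.range n, W i ω := by
      rw [Finset.mul_sum, ← Finset.sum_add_distrib]
      refine Finset.sum_congr rfl fun i _ => ?_
      simp only [X, W]
      rw [hgx _ (hω5 i), hpp _ (hω5 i)]
      ring
    rw [e1, e2]
    field_simp
    ring
  intro s hs
  rw [hsqrt]
  refine IsRealLimsup.of_eq_mul hf_mono ht hd hne
    ((eventually_gt_atTop 0).mono fun n hn => (hspecB n hn).1) hω3 ha hω4 hfB ?_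
  rcases hs with rfl | rfl
  · simpa using hω1
  · simpa [neg_div, Finset.sum_neg_distrib] using hω2

end

theorem bajExpectation_one {Ω : Type*} [MeasurableSpace Ω] (P : Measure Ω)
    [IsProbabilityMeasure P] (I : Set ℝ) (f : ℝ → ℝ) (ξ : Ω → ℝ) :
    bajExpectation P I f (fun _ => 1) ξ = quasiExpectation P I f ξ := by
  simp [bajExpectation, quasiExpectation]

theorem bajSigmaSq_one {Ω : Type*} [MeasurableSpace Ω] (P : Measure Ω)
    [IsProbabilityMeasure P] (I : Set ℝ) (f : ℝ → ℝ) (ξ : Ω → ℝ) :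
    bajSigmaSq P I f (fun _ => 1) ξ =
      variance (fun ω => f (ξ ω)) P / deriv f (quasiExpectation P I f ξ) ^ 2 := by
  rw [bajSigmaSq, bajExpectation_one, covariance_const_left]
  have : variance (fun _ : Ω => (1 : ℝ)) P = 0 := by
    simp [variance_eq_integral]
  rw [this]
  simp [div_eq_inv_mul]

theorem mainTheorem5 {Ω : Type*} [MeasurableSpace Ω] (P : Measure Ω) [IsProbabilityMeasure P]
    (I : Set ℝ) (hI : I.OrdConnected) (hI' : I.Nontrivial)
    (f : ℝ → ℝ) (hf_cont : ContinuousOn f I) (hf_mono : StrictMonoOn f I)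
    (ξ : ℕ → Ω → ℝ) (hξ_meas : ∀ n, Measurable (ξ n)) (hξ_indep : iIndepFun ξ P)
    (hξ_ident : ∀ n, IdentDistrib (ξ n) (ξ 0) P P)
    (hξ_mem : ∀ᵐ ω ∂P, ξ 0 ω ∈ I)
    (hξ_nonconst : ¬ ∃ c : ℝ, ∀ᵐ ω ∂P, ξ 0 ω = c) :
    -- Bajraktarević means
    (∀ p : ℝ → ℝ, Measurable (fun x : I => p x) → (∀ x ∈ I, 0 < p x) →
      Integrable (fun ω => p (ξ 0 ω) ^ 2) P →
      Integrable (fun ω => p (ξ 0 ω) ^ 2 * f (ξ 0 ω) ^ 2) P →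
      bajExpectation P I f p (ξ 0) ∈ interior I →
      DifferentiableAt ℝ f (bajExpectation P I f p (ξ 0)) →
      deriv f (bajExpectation P I f p (ξ 0)) ≠ 0 →
      f (bajExpectation P I f p (ξ 0)) =
          (∫ ω, p (ξ 0 ω) * f (ξ 0 ω) ∂P) / ∫ ω, p (ξ 0 ω) ∂P ∧
      0 < bajSigmaSq P I f p (ξ 0) ∧
      (∀ᵐ ω ∂P, limsup (fun n : ℕ =>
          (((bajMean I f p (fun i : Fin n => ξ i ω) - bajExpectation P I f p (ξ 0))
            / lilScale n : ℝ) : EReal)) atTop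
          = ((√(bajSigmaSq P I f p (ξ 0)) : ℝ) : EReal)) ∧
      (∀ᵐ ω ∂P, liminf (fun n : ℕ =>
          (((bajMean I f p (fun i : Fin n => ξ i ω) - bajExpectation P I f p (ξ 0))
            / lilScale n : ℝ) : EReal)) atTop
          = ((-√(bajSigmaSq P I f p (ξ 0)) : ℝ) : EReal))) ∧
    -- quasi-arithmetic means
    (Integrable (fun ω => f (ξ 0 ω) ^ 2) P →
      quasiExpectation P I f (ξ 0) ∈ interior I →
      DifferentiableAt ℝ f (quasiExpectation P I f (ξ 0)) →
      deriv f (quasiExpectation P I f (ξ 0)) ≠ 0 →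
      f (quasiExpectation P I f (ξ 0)) = ∫ ω, f (ξ 0 ω) ∂P ∧
      (∀ᵐ ω ∂P, limsup (fun n : ℕ =>
          (((quasiMean I f (fun i : Fin n => ξ i ω) - quasiExpectation P I f (ξ 0))
            / lilScale n : ℝ) : EReal)) atTop
          = ((√(variance (fun ω => f (ξ 0 ω)) P)
              / deriv f (quasiExpectation P I f (ξ 0)) : ℝ) : EReal)) ∧
      (∀ᵐ ω ∂P, liminf (fun n : ℕ =>
          (((quasiMean I f (fun i : Fin n => ξ i ω) - quasiExpectation P I f (ξ 0))
            / lilScale n : ℝ) : EReal)) atTop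
          = ((-(√(variance (fun ω => f (ξ 0 ω)) P)
              / deriv f (quasiExpectation P I f (ξ 0))) : ℝ) : EReal))) := by
  have hlim {p : ℝ → ℝ} (hp : Measurable (fun x : I => p x)) (hp0 : ∀ x ∈ I, 0 < p x)
      (hp2 : Integrable (fun ω => p (ξ 0 ω) ^ 2) P)
      (hpf2 : Integrable (fun ω => p (ξ 0 ω) ^ 2 * f (ξ 0 ω) ^ 2) P)
      (ht : bajExpectation P I f p (ξ 0) ∈ interior I)
      (hd : DifferentiableAt ℝ f (bajExpectation P I f p (ξ 0)))
      (hne : deriv f (bajExpectation P I f p (ξ 0)) ≠ 0) :=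
    bajMean_isRealLimsup hI hf_cont hf_mono hξ_meas hξ_indep hξ_ident hξ_mem hξ_nonconst
      hp hp0 hp2 hpf2 ht hd hne
  refine ⟨fun p hp hp0 hp2 hpf2 ht hd hne => ?_, fun hf2 ht hd hne => ?_⟩
  · obtain ⟨h1, h2, h3⟩ := hlim hp hp0 hp2 hpf2 ht hd hne
    refine ⟨h1, h2, ?_, ?_⟩
    · filter_upwards [h3] with ω hω
      simpa only [one_mul] using (hω 1 (Or.inl rfl)).limsup_eq
    · filter_upwards [h3] with ω hω
      exact IsRealLimsup.liminf_eq (by simpa only [neg_one_mul] using hω (-1) (Or.inr rfl))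
  · have hsqrt : √(bajSigmaSq P I f (fun _ => 1) (ξ 0)) =
        √(variance (fun ω => f (ξ 0 ω)) P) / deriv f (quasiExpectation P I f (ξ 0)) := by
      rw [bajSigmaSq_one, Real.sqrt_div (variance_nonneg _ _),
        Real.sqrt_sq (deriv_pos_of_strictMonoOn hf_mono ht hd hne).le]
    have hE := bajExpectation_one P I f (ξ 0)
    obtain ⟨h1, -, h3⟩ := hlim (p := fun _ => 1) measurable_const (fun _ _ => one_pos)
      (by simp) (by simpa using hf2) (by rwa [hE]) (by rwa [hE]) (by rwa [hE])
    rw [hE] at h1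
    simp only [hsqrt, hE, bajMean_one] at h3
    refine ⟨by simpa using h1, ?_, ?_⟩
    · filter_upwards [h3] with ω hω
      simpa only [one_mul] using (hω 1 (Or.inl rfl)).limsup_eq
    · filter_upwards [h3] with ω hω
      exact IsRealLimsup.liminf_eq (by simpa only [neg_one_mul] using hω (-1) (Or.inr rfl))
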